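/- Let $k\ge 1$ be an integer and let $a\neq 0$ be a complex number. Let $\zeta^{(k)}$ denote the $k$-th derivative of the Riemann zeta function, and call a complex number $s\neq 1$ with $\zeta^{(k)}(s)=a$ an $a$-point of $\zeta^{(k)}$. For each real $T$, the number $N_k(a;1,T)$ of $a$-points of $\zeta^{(k)}$ with $1<\operatorname{Im}s<T$, counted with multiplicity (the multiplicity of an $a$-point $s_0$ being the order of vanishing of $\zeta^{(k)}(s)-a$ at $s=s_0$), is finite, and $$N_k(a;1,T)=\frac{T}{2\pi}\log\frac{T}{2\pi}-\frac{T}{2\pi}+O(\log T)\qquad(T\to\infty),$$ where the implied constant may depend on $k$ and $a$. -/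

import Mathlib

/-- The `a`-points of the `k`-th derivative of the Riemann zeta function with imaginary part
strictly between `T₁` and `T₂`. -/
def zetaDerivAPoints (k : ℕ) (a : ℂ) (T₁ T₂ : ℝ) : Set ℂ :=
  {s : ℂ | s ≠ 1 ∧ iteratedDeriv k riemannZeta s = a ∧ T₁ < s.im ∧ s.im < T₂}

/-- The multiplicity of `s` as a root of `ζ^(k)(z) = a`, that is, the order of vanishing of
`ζ^(k) - a` at `s`. -/
noncomputable def zetaDerivAPointMult (k : ℕ) (a s : ℂ) : ℕ :=
  analyticOrderNatAt (fun z : ℂ => iteratedDeriv k riemannZeta z - a) s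

/-- `N_k(a; T₁, T₂)`: the number of `a`-points of `ζ^(k)` with imaginary part strictly between
`T₁` and `T₂`, counted with multiplicity. -/
noncomputable def zetaDerivAPointCount (k : ℕ) (a : ℂ) (T₁ T₂ : ℝ) : ℕ :=
  ∑ᶠ s ∈ zetaDerivAPoints k a T₁ T₂, zetaDerivAPointMult k a s

open Complex Set Filter Topology

/-! Apply the argument principle (`rectIntegral_logDeriv`) to `F = ζ⁽ᵏ⁾ - a` on a rectangle `[-2, c]
× [T₀, T]` with `c` and `T₀` fixed, and take imaginary parts of the boundary integral of `F'/F`. The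
bottom edge does not depend on `T`, and the other three are controlled as follows.

Right edge: since `k ≥ 1`, `ζ⁽ᵏ⁾` tends to `0` as `re z → ∞`, so `F` is close to `-a ≠ 0` and has a
logarithm with bounded imaginary part (`exists_log_iteratedDeriv_riemannZeta_sub_right`).

Left edge: the functional equation and Stirling's formula give `ζ(1 - s) = exp (H s)`, where `H'`
grows like `log s` and `H''` is bounded. Hence `ζ⁽ᵏ⁾(1 - s) = (-1)ᵏ exp(H) (H')ᵏ q` with `q → 1`. As
`exp(-H) → 0`, the constant `a` is negligible, and `F` has a logarithm with imaginary part `Im H +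
O(1)` (`exists_log_iteratedDeriv_riemannZeta_sub_left`). At `s = 3 - iT` this is `T - T log(T/2π) +
O(1)`, which produces the main term.

Top edge: `F` grows polynomially on discs of fixed radius and is bounded below at `c + iT`, so
Backlund's argument bounds the variation by `O(log T)` (`abs_im_integral_logDeriv_le`).

The two logarithms also exclude `a`-points outside the strip at large heights. A height `T` carrying
`a`-points is replaced by a slightly smaller one, which changes neither the count nor the order of
the error. -/

/-! ### Dividing out the zeros of a holomorphic function -/

lemma finite_zeros_of_isCompact {F : ℂ → ℂ} {U K : Set ℂ} (hU : IsOpen U) (hc : IsPreconnected U)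
    (hF : DifferentiableOn ℂ F U) {s₀ : ℂ} (hs₀ : s₀ ∈ U) (h0 : F s₀ ≠ 0) (hK : IsCompact K)
    (hKU : K ⊆ U) : {z ∈ K | F z = 0}.Finite := by
  have hA : AnalyticOnNhd ℂ F U := hF.analyticOnNhd hU
  by_contra hinf
  obtain ⟨x, hx, hacc⟩ := Set.Infinite.exists_accPt_of_subset_isCompact hinf hK (fun z hz => hz.1)
  rw [accPt_iff_frequently] at hacc
  have h1 : ∃ᶠ z in 𝓝[≠] x, F z = 0 := by
    rw [frequently_nhdsWithin_iff]
    exact hacc.mono fun z hz => ⟨hz.2.2, hz.1⟩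
  exact h0 (hA.eqOn_zero_of_preconnected_of_frequently_eq_zero hc (hKU hx) h1 hs₀)

lemma analyticOrderAt_ne_top_of_ne_zero {F : ℂ → ℂ} {U : Set ℂ} (hU : IsOpen U)
    (hc : IsPreconnected U) (hF : DifferentiableOn ℂ F U) {s₀ : ℂ} (hs₀ : s₀ ∈ U) (h0 : F s₀ ≠ 0)
    {z : ℂ} (hz : z ∈ U) : analyticOrderAt F z ≠ ⊤ := by
  have hA : AnalyticOnNhd ℂ F U := hF.analyticOnNhd hU
  refine hA.analyticOrderAt_ne_top_of_isPreconnected hc hs₀ hz ?_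
  rw [(hA s₀ hs₀).analyticOrderAt_eq_zero.2 h0]
  simp

/-- Divide by `z - ρ` repeatedly with `dslope`. Its defining identity holds at every point, so the
factorization is an equality of functions on all of `ℂ`, even though `G` is holomorphic only on `U`.
-/
lemma exists_eq_pow_mul {U : Set ℂ} (hU : IsOpen U) {ρ : ℂ} (hρ : ρ ∈ U) (n : ℕ) :
    ∀ {F : ℂ → ℂ}, DifferentiableOn ℂ F U → analyticOrderAt F ρ = n →
    ∃ G : ℂ → ℂ, DifferentiableOn ℂ G U ∧ (∀ z, F z = (z - ρ) ^ n * G z) ∧ G ρ ≠ 0 := by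
  induction n with
  | zero =>
    intro F hF h
    have hA : AnalyticAt ℂ F ρ := hF.analyticAt (hU.mem_nhds hρ)
    exact ⟨F, hF, by simp, hA.analyticOrderAt_eq_zero.1 (by simpa using h)⟩
  | succ n ih =>
    intro F hF h
    have hA : AnalyticAt ℂ F ρ := hF.analyticAt (hU.mem_nhds hρ)
    have hF0 : F ρ = 0 := hA.analyticOrderAt_ne_zero.1 (by rw [h]; simp)
    have hd : DifferentiableOn ℂ (dslope F ρ) U :=
      (differentiableOn_dslope (hU.mem_nhds hρ)).2 hF
    have hdA : AnalyticAt ℂ (dslope F ρ) ρ := hd.analyticAt (hU.mem_nhds hρ)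
    have hE : ∀ z, F z = (z - ρ) * dslope F ρ z := by
      intro z
      have := sub_smul_dslope F ρ z
      simp only [smul_eq_mul, hF0, sub_zero] at this
      exact this.symm
    have hid : AnalyticAt ℂ (fun z => z - ρ) ρ := by fun_prop
    have hord : analyticOrderAt (dslope F ρ) ρ = n := by
      have h1 : analyticOrderAt (fun z : ℂ => z - ρ) ρ = (1 : ℕ) := by
        rw [hid.analyticOrderAt_eq_natCast]
        exact ⟨fun _ => 1, analyticAt_const, one_ne_zero, by simp⟩
      have h2 : F = (fun z => z - ρ) * dslope F ρ := funext hE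
      rw [h2, analyticOrderAt_mul hid hdA, h1] at h
      generalize analyticOrderAt (dslope F ρ) ρ = m at h
      cases m with
      | top => simp at h; exact absurd h (by exact_mod_cast ENat.top_ne_natCast (n + 1))
      | coe m => norm_cast at h ⊢; omega
    obtain ⟨G, hG, hFG, hne⟩ := ih hd hord
    exact ⟨G, hG, fun z => by rw [hE z, hFG z]; ring, hne⟩

lemma exists_eq_prod_mul {U : Set ℂ} (hU : IsOpen U) {F : ℂ → ℂ} (hF : DifferentiableOn ℂ F U)
    (S : Finset ℂ) (hS : ∀ ρ ∈ S, ρ ∈ U) (htop : ∀ ρ ∈ S, analyticOrderAt F ρ ≠ ⊤) :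
    ∃ G : ℂ → ℂ, DifferentiableOn ℂ G U ∧
      (∀ z, F z = (∏ ρ ∈ S, (z - ρ) ^ analyticOrderNatAt F ρ) * G z) ∧ ∀ ρ ∈ S, G ρ ≠ 0 := by
  induction S using Finset.induction_on with
  | empty => exact ⟨F, hF, by simp, by simp⟩
  | insert ρ S hρS ih =>
    obtain ⟨G, hG, hFG, hne⟩ := ih (fun r hr => hS r (Finset.mem_insert_of_mem hr))
      (fun r hr => htop r (Finset.mem_insert_of_mem hr))
    have hρU := hS ρ (Finset.mem_insert_self _ _)
    have hGA : AnalyticAt ℂ G ρ := hG.analyticAt (hU.mem_nhds hρU)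
    have hPA : AnalyticAt ℂ (fun z => ∏ r ∈ S, (z - r) ^ analyticOrderNatAt F r) ρ := by
      refine Finset.analyticAt_fun_prod _ fun r _ => ?_
      fun_prop
    have hP0 : (∏ r ∈ S, (ρ - r) ^ analyticOrderNatAt F r) ≠ 0 := by
      refine Finset.prod_ne_zero_iff.2 fun r hr => pow_ne_zero _ (sub_ne_zero.2 ?_)
      rintro rfl
      exact hρS hr
    -- The factors already removed do not vanish at `ρ`, so `G` keeps the order of `F` there.
    have hord : analyticOrderAt G ρ = (analyticOrderNatAt F ρ : ℕ) := by
      have h1 := htop ρ (Finset.mem_insert_self _ _)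
      have h2 : F = (fun z => ∏ r ∈ S, (z - r) ^ analyticOrderNatAt F r) * G := funext hFG
      have h3 : analyticOrderAt F ρ = analyticOrderAt G ρ := by
        conv_lhs => rw [h2]
        rw [analyticOrderAt_mul hPA hGA, hPA.analyticOrderAt_eq_zero.2 hP0, zero_add]
      rw [← h3, Nat.cast_analyticOrderNatAt h1]
    obtain ⟨G', hG', hGG', hne'⟩ := exists_eq_pow_mul hU hρU _ hG hord
    refine ⟨G', hG', fun z => ?_, fun r hr => ?_⟩
    · rw [Finset.prod_insert hρS, hFG z, hGG' z]
      ring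
    · rcases Finset.mem_insert.1 hr with rfl | hr
      · exact hne'
      · intro h0
        apply hne r hr
        rw [hGG' r, h0, mul_zero]

lemma logDeriv_eq_sum_add {U : Set ℂ} (hU : IsOpen U) {F G : ℂ → ℂ} (hG : DifferentiableOn ℂ G U)
    {S : Finset ℂ} {m : ℂ → ℕ} (h : ∀ z, F z = (∏ ρ ∈ S, (z - ρ) ^ m ρ) * G z) {z : ℂ}
    (hz : z ∈ U) (hS : z ∉ S) (hGz : G z ≠ 0) :
    logDeriv F z = ∑ ρ ∈ S, m ρ * (z - ρ)⁻¹ + logDeriv G z := by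
  have hne : ∀ ρ ∈ S, (z - ρ) ^ m ρ ≠ 0 := fun ρ hρ => by
    refine pow_ne_zero _ (sub_ne_zero.2 ?_)
    rintro rfl
    exact hS hρ
  have hd : ∀ ρ ∈ S, DifferentiableAt ℂ (fun z : ℂ => (z - ρ) ^ m ρ) z := fun ρ _ => by fun_prop
  have hP : DifferentiableAt ℂ (fun z : ℂ => ∏ ρ ∈ S, (z - ρ) ^ m ρ) z :=
    DifferentiableAt.fun_finsetProd hd
  have hP0 : (fun z : ℂ => ∏ ρ ∈ S, (z - ρ) ^ m ρ) z ≠ 0 := Finset.prod_ne_zero_iff.2 hne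
  rw [funext h, logDeriv_mul z hP0 hGz hP (hG.differentiableAt (hU.mem_nhds hz)),
    logDeriv_prod hne hd]
  congr 1
  refine Finset.sum_congr rfl fun ρ _ => ?_
  rw [logDeriv_fun_pow (by fun_prop)]
  congr 1
  simp [logDeriv_apply]

/-! ### Rectangle integrals and the argument principle -/

/-- The boundary integral of `f` over the rectangle `[x₀, x₁] × [y₀, y₁]`. -/
noncomputable def rectIntegral (f : ℂ → ℂ) (x₀ x₁ y₀ y₁ : ℝ) : ℂ :=
  (∫ x : ℝ in x₀..x₁, f (x + y₀ * I)) - (∫ x : ℝ in x₀..x₁, f (x + y₁ * I)) +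
    I * (∫ y : ℝ in y₀..y₁, f (x₁ + y * I)) - I * (∫ y : ℝ in y₀..y₁, f (x₀ + y * I))

/-- The boundary of the rectangle `[x₀, x₁] × [y₀, y₁]`. -/
def rectBoundary (x₀ x₁ y₀ y₁ : ℝ) : Set ℂ :=
  {z | z.re ∈ Icc x₀ x₁ ∧ z.im ∈ Icc y₀ y₁ ∧
    (z.re = x₀ ∨ z.re = x₁ ∨ z.im = y₀ ∨ z.im = y₁)}

section

variable {x₀ x₁ y₀ y₁ : ℝ} {f g : ℂ → ℂ}

lemma intervalIntegrable_horizontal {y : ℝ} (hx : x₀ ≤ x₁) {B : Set ℂ} (hf : ContinuousOn f B)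
    (hB : ∀ x ∈ Icc x₀ x₁, (x + y * I : ℂ) ∈ B) :
    IntervalIntegrable (fun x : ℝ => f (x + y * I)) MeasureTheory.volume x₀ x₁ := by
  apply ContinuousOn.intervalIntegrable
  rw [uIcc_of_le hx]
  exact hf.comp (by fun_prop) hB

lemma intervalIntegrable_vertical {x : ℝ} (hy : y₀ ≤ y₁) {B : Set ℂ} (hf : ContinuousOn f B)
    (hB : ∀ y ∈ Icc y₀ y₁, (x + y * I : ℂ) ∈ B) :
    IntervalIntegrable (fun y : ℝ => f (x + y * I)) MeasureTheory.volume y₀ y₁ := by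
  apply ContinuousOn.intervalIntegrable
  rw [uIcc_of_le hy]
  exact hf.comp (by fun_prop) hB

lemma bottom_mem_rectBoundary (hy : y₀ ≤ y₁) : ∀ x ∈ Icc x₀ x₁,
    (x + y₀ * I : ℂ) ∈ rectBoundary x₀ x₁ y₀ y₁ := by
  intro x hx
  simp [rectBoundary, hx.1, hx.2, hy]

lemma top_mem_rectBoundary (hy : y₀ ≤ y₁) : ∀ x ∈ Icc x₀ x₁,
    (x + y₁ * I : ℂ) ∈ rectBoundary x₀ x₁ y₀ y₁ := by
  intro x hx
  simp [rectBoundary, hx.1, hx.2, hy]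

lemma right_mem_rectBoundary (hx : x₀ ≤ x₁) : ∀ y ∈ Icc y₀ y₁,
    (x₁ + y * I : ℂ) ∈ rectBoundary x₀ x₁ y₀ y₁ := by
  intro x hx
  simp_all [rectBoundary]

lemma left_mem_rectBoundary (hx : x₀ ≤ x₁) : ∀ y ∈ Icc y₀ y₁,
    (x₀ + y * I : ℂ) ∈ rectBoundary x₀ x₁ y₀ y₁ := by
  intro x hx
  simp_all [rectBoundary]

lemma rectIntegral_add (hx : x₀ ≤ x₁) (hy : y₀ ≤ y₁)
    (hf : ContinuousOn f (rectBoundary x₀ x₁ y₀ y₁))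
    (hg : ContinuousOn g (rectBoundary x₀ x₁ y₀ y₁)) :
    rectIntegral (fun z => f z + g z) x₀ x₁ y₀ y₁ =
      rectIntegral f x₀ x₁ y₀ y₁ + rectIntegral g x₀ x₁ y₀ y₁ := by
  unfold rectIntegral
  rw [intervalIntegral.integral_add
      (intervalIntegrable_horizontal hx hf (bottom_mem_rectBoundary hy))
      (intervalIntegrable_horizontal hx hg (bottom_mem_rectBoundary hy)),
    intervalIntegral.integral_add
      (intervalIntegrable_horizontal hx hf (top_mem_rectBoundary hy))
      (intervalIntegrable_horizontal hx hg (top_mem_rectBoundary hy)),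
    intervalIntegral.integral_add
      (intervalIntegrable_vertical hy hf (right_mem_rectBoundary hx))
      (intervalIntegrable_vertical hy hg (right_mem_rectBoundary hx)),
    intervalIntegral.integral_add
      (intervalIntegrable_vertical hy hf (left_mem_rectBoundary hx))
      (intervalIntegrable_vertical hy hg (left_mem_rectBoundary hx))]
  ring

lemma rectIntegral_const_mul (c : ℂ) (f : ℂ → ℂ) :
    rectIntegral (fun z => c * f z) x₀ x₁ y₀ y₁ = c * rectIntegral f x₀ x₁ y₀ y₁ := by
  unfold rectIntegral
  simp only [intervalIntegral.integral_const_mul]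
  ring

lemma rectIntegral_sum {ι : Type*} (S : Finset ι) {f : ι → ℂ → ℂ} (hx : x₀ ≤ x₁) (hy : y₀ ≤ y₁)
    (hf : ∀ i ∈ S, ContinuousOn (f i) (rectBoundary x₀ x₁ y₀ y₁)) :
    rectIntegral (fun z => ∑ i ∈ S, f i z) x₀ x₁ y₀ y₁ =
      ∑ i ∈ S, rectIntegral (f i) x₀ x₁ y₀ y₁ := by
  classical
  induction S using Finset.induction_on with
  | empty => simp [rectIntegral]
  | insert i S hi ih =>
    simp only [Finset.sum_insert hi]
    rw [rectIntegral_add hx hy (hf i (Finset.mem_insert_self _ _)), ih]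
    · exact fun j hj => hf j (Finset.mem_insert_of_mem hj)
    · exact continuousOn_finsetSum _ fun j hj => hf j (Finset.mem_insert_of_mem hj)

lemma rectIntegral_congr (hx : x₀ ≤ x₁) (hy : y₀ ≤ y₁)
    (h : ∀ z ∈ rectBoundary x₀ x₁ y₀ y₁, f z = g z) :
    rectIntegral f x₀ x₁ y₀ y₁ = rectIntegral g x₀ x₁ y₀ y₁ := by
  have e1 : EqOn (fun x : ℝ => f (x + y₀ * I)) (fun x : ℝ => g (x + y₀ * I)) (uIcc x₀ x₁) :=
    fun x hx' => h _ (bottom_mem_rectBoundary hy x (by rwa [uIcc_of_le hx] at hx'))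
  have e2 : EqOn (fun x : ℝ => f (x + y₁ * I)) (fun x : ℝ => g (x + y₁ * I)) (uIcc x₀ x₁) :=
    fun x hx' => h _ (top_mem_rectBoundary hy x (by rwa [uIcc_of_le hx] at hx'))
  have e3 : EqOn (fun y : ℝ => f (x₁ + y * I)) (fun y : ℝ => g (x₁ + y * I)) (uIcc y₀ y₁) :=
    fun y hy' => h _ (right_mem_rectBoundary hx y (by rwa [uIcc_of_le hy] at hy'))
  have e4 : EqOn (fun y : ℝ => f (x₀ + y * I)) (fun y : ℝ => g (x₀ + y * I)) (uIcc y₀ y₁) :=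
    fun y hy' => h _ (left_mem_rectBoundary hx y (by rwa [uIcc_of_le hy] at hy'))
  unfold rectIntegral
  rw [intervalIntegral.integral_congr e1, intervalIntegral.integral_congr e2,
    intervalIntegral.integral_congr e3, intervalIntegral.integral_congr e4]

lemma rectIntegral_eq_zero (hx : x₀ ≤ x₁) (hy : y₀ ≤ y₁)
    (hf : DifferentiableOn ℂ f {z | z.re ∈ Icc x₀ x₁ ∧ z.im ∈ Icc y₀ y₁}) :
    rectIntegral f x₀ x₁ y₀ y₁ = 0 := by
  have := integral_boundary_rect_eq_zero_of_differentiableOn f ⟨x₀, y₀⟩ ⟨x₁, y₁⟩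
    (by rw [uIcc_of_le hx, uIcc_of_le hy]; exact hf)
  simpa [rectIntegral] using this

end

lemma integral_horizontal_of_hasDerivAt {f ℓ : ℂ → ℂ} {a b y : ℝ}
    (h : ∀ x ∈ uIcc a b, HasDerivAt ℓ (f (x + y * I)) (x + y * I))
    (hc : ContinuousOn (fun x : ℝ => f (x + y * I)) (uIcc a b)) :
    ∫ x : ℝ in a..b, f (x + y * I) = ℓ (b + y * I) - ℓ (a + y * I) := by
  refine intervalIntegral.integral_eq_sub_of_hasDerivAt (f := fun x : ℝ => ℓ (x + y * I))
    (fun x hx => ?_) hc.intervalIntegrable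
  have h1 : HasDerivAt (fun x : ℝ => (x + y * I : ℂ)) 1 x :=
    (Complex.ofRealCLM.hasDerivAt (x := x)).add_const (y * I)
  simpa using! (h x hx).comp x h1

lemma integral_vertical_of_hasDerivAt {f ℓ : ℂ → ℂ} {a b x : ℝ}
    (h : ∀ y ∈ uIcc a b, HasDerivAt ℓ (f (x + y * I)) (x + y * I))
    (hc : ContinuousOn (fun y : ℝ => f (x + y * I)) (uIcc a b)) :
    I * ∫ y : ℝ in a..b, f (x + y * I) = ℓ (x + b * I) - ℓ (x + a * I) := by
  rw [← intervalIntegral.integral_const_mul]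
  refine intervalIntegral.integral_eq_sub_of_hasDerivAt (f := fun y : ℝ => ℓ (x + y * I))
    (fun y hy => ?_) (continuousOn_const.mul hc).intervalIntegrable
  have h1 : HasDerivAt (fun y : ℝ => (x + y * I : ℂ)) (1 * I) y :=
    ((Complex.ofRealCLM.hasDerivAt (x := y)).mul_const I).const_add (x : ℂ)
  have := (h y hy).comp y h1
  simp only [one_mul] at this
  rw [mul_comm]
  exact this

lemma log_sub_log_neg_of_im_pos {z : ℂ} (hz : 0 < z.im) : log z - log (-z) = Real.pi * I := by
  apply Complex.ext
  · simp [log_re]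
  · simp [log_im, arg_neg_eq_arg_sub_pi_of_im_pos hz]

lemma log_sub_log_neg_of_im_neg {z : ℂ} (hz : z.im < 0) : log z - log (-z) = -(Real.pi * I) := by
  have := log_sub_log_neg_of_im_pos (z := -z) (by simpa using hz)
  rw [neg_neg] at this
  rw [← this]; ring

/-- The primitive `log (z - ρ)` serves on three edges. The left edge crosses the branch cut, so `log
(-(z - ρ))` is used there; the two branches differ by `πi` and `-πi` at the left corners, and the
mismatch adds up to `2πi`. -/
lemma rectIntegral_inv_sub {x₀ x₁ y₀ y₁ : ℝ} {ρ : ℂ} (h1 : x₀ < ρ.re) (h2 : ρ.re < x₁)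
    (h3 : y₀ < ρ.im) (h4 : ρ.im < y₁) :
    rectIntegral (fun z => (z - ρ)⁻¹) x₀ x₁ y₀ y₁ = 2 * Real.pi * I := by
  have key : ∀ z : ℂ, z - ρ ∈ slitPlane →
      HasDerivAt (fun z => log (z - ρ)) ((z - ρ)⁻¹) z := fun z hz => by
    simpa using ((hasDerivAt_id z).sub_const ρ).clog hz
  have key' : ∀ z : ℂ, -(z - ρ) ∈ slitPlane →
      HasDerivAt (fun z => log (-(z - ρ))) ((z - ρ)⁻¹) z := fun z hz => by
    have := ((hasDerivAt_id z).sub_const ρ).neg.clog hz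
    convert! this using 1
    simp only [Pi.neg_apply, id_eq]
    rw [neg_div_neg_eq, one_div]
  have eb := integral_horizontal_of_hasDerivAt (f := fun z => (z - ρ)⁻¹)
    (ℓ := fun z => log (z - ρ)) (a := x₀) (b := x₁) (y := y₀)
    (fun x _ => key _ (Or.inr (by simp; linarith)))
    (ContinuousOn.inv₀ (by fun_prop) fun x _ h => by
      have := congrArg im h; simp at this; linarith)
  have et := integral_horizontal_of_hasDerivAt (f := fun z => (z - ρ)⁻¹)
    (ℓ := fun z => log (z - ρ)) (a := x₀) (b := x₁) (y := y₁)
    (fun x _ => key _ (Or.inr (by simp; linarith)))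
    (ContinuousOn.inv₀ (by fun_prop) fun x _ h => by
      have := congrArg im h; simp at this; linarith)
  have er := integral_vertical_of_hasDerivAt (f := fun z => (z - ρ)⁻¹)
    (ℓ := fun z => log (z - ρ)) (a := y₀) (b := y₁) (x := x₁)
    (fun x _ => key _ (Or.inl (by simp; linarith)))
    (ContinuousOn.inv₀ (by fun_prop) fun x _ h => by
      have := congrArg re h; simp at this; linarith)
  have el := integral_vertical_of_hasDerivAt (f := fun z => (z - ρ)⁻¹)
    (ℓ := fun z => log (-(z - ρ))) (a := y₀) (b := y₁) (x := x₀)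
    (fun x _ => key' _ (Or.inl (by simp; linarith)))
    (ContinuousOn.inv₀ (by fun_prop) fun x _ h => by
      have := congrArg re h; simp at this; linarith)
  have c1 := log_sub_log_neg_of_im_pos (z := x₀ + y₁ * I - ρ) (by simp; linarith)
  have c2 := log_sub_log_neg_of_im_neg (z := x₀ + y₀ * I - ρ) (by simp; linarith)
  unfold rectIntegral
  rw [eb, et, er, el]
  linear_combination c1 - c2

lemma continuousOn_logDeriv {F : ℂ → ℂ} {U B : Set ℂ} (hU : IsOpen U)
    (hF : DifferentiableOn ℂ F U) (hB : B ⊆ U) (h0 : ∀ z ∈ B, F z ≠ 0) :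
    ContinuousOn (logDeriv F) B := by
  have h1 : ContinuousOn (deriv F) U := (hF.deriv hU).continuousOn
  exact (h1.mono hB).div (hF.continuousOn.mono hB) h0

lemma differentiableOn_logDeriv {F : ℂ → ℂ} {U B : Set ℂ} (hU : IsOpen U)
    (hF : DifferentiableOn ℂ F U) (hB : B ⊆ U) (h0 : ∀ z ∈ B, F z ≠ 0) :
    DifferentiableOn ℂ (logDeriv F) B :=
  ((hF.deriv hU).mono hB).div (hF.mono hB) h0

/-- The argument principle for a rectangle. -/
theorem rectIntegral_logDeriv {F : ℂ → ℂ} {U : Set ℂ} (hU : IsOpen U)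
    (hF : DifferentiableOn ℂ F U) {x₀ x₁ y₀ y₁ : ℝ} (hx : x₀ ≤ x₁) (hy : y₀ ≤ y₁)
    (hR : {z : ℂ | z.re ∈ Icc x₀ x₁ ∧ z.im ∈ Icc y₀ y₁} ⊆ U) (S : Finset ℂ)
    (hS : ∀ z : ℂ, z.re ∈ Icc x₀ x₁ → z.im ∈ Icc y₀ y₁ → (F z = 0 ↔ z ∈ S))
    (hSi : ∀ z ∈ S, z.re ∈ Ioo x₀ x₁ ∧ z.im ∈ Ioo y₀ y₁)
    (htop : ∀ z ∈ S, analyticOrderAt F z ≠ ⊤) :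
    rectIntegral (logDeriv F) x₀ x₁ y₀ y₁ =
      2 * Real.pi * I * ((∑ ρ ∈ S, analyticOrderNatAt F ρ : ℕ) : ℂ) := by
  obtain ⟨G, hG, hFG, hGS⟩ := exists_eq_prod_mul hU hF S
    (fun ρ hρ => hR ⟨Ioo_subset_Icc_self (hSi ρ hρ).1, Ioo_subset_Icc_self (hSi ρ hρ).2⟩) htop
  have hG0 : ∀ z ∈ {z : ℂ | z.re ∈ Icc x₀ x₁ ∧ z.im ∈ Icc y₀ y₁}, G z ≠ 0 := by
    intro z hz h0
    by_cases hzS : z ∈ S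
    · exact hGS z hzS h0
    · exact hzS ((hS z hz.1 hz.2).1 (by rw [hFG z, h0, mul_zero]))
  have hBR : rectBoundary x₀ x₁ y₀ y₁ ⊆ {z : ℂ | z.re ∈ Icc x₀ x₁ ∧ z.im ∈ Icc y₀ y₁} :=
    fun z hz => ⟨hz.1, hz.2.1⟩
  have hBS : ∀ z ∈ rectBoundary x₀ x₁ y₀ y₁, z ∉ S := by
    intro z hz hzS
    obtain ⟨⟨a, b⟩, c, d⟩ := hSi z hzS
    rcases hz.2.2 with h | h | h | h <;> linarith
  have hinv : ∀ ρ ∈ S, ContinuousOn (fun z : ℂ => (z - ρ)⁻¹) (rectBoundary x₀ x₁ y₀ y₁) := by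
    intro ρ hρ
    refine ContinuousOn.inv₀ (by fun_prop) fun z hz h => hBS z hz ?_
    rwa [sub_eq_zero.1 h]
  have hc1 : ∀ ρ ∈ S, ContinuousOn (fun z : ℂ => (analyticOrderNatAt F ρ : ℂ) * (z - ρ)⁻¹)
      (rectBoundary x₀ x₁ y₀ y₁) := fun ρ hρ => continuousOn_const.mul (hinv ρ hρ)
  rw [rectIntegral_congr hx hy (g := fun z => (∑ ρ ∈ S, (analyticOrderNatAt F ρ : ℂ) * (z - ρ)⁻¹) +
      logDeriv G z) fun z hz =>
      logDeriv_eq_sum_add hU hG hFG (hR (hBR hz)) (hBS z hz) (hG0 z (hBR hz)),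
    rectIntegral_add hx hy (continuousOn_finsetSum _ hc1)
      (continuousOn_logDeriv hU hG (hBR.trans hR) fun z hz => hG0 z (hBR hz)),
    rectIntegral_sum S hx hy hc1,
    rectIntegral_eq_zero hx hy (differentiableOn_logDeriv hU hG hR hG0), add_zero]
  push_cast
  rw [Finset.mul_sum]
  refine Finset.sum_congr rfl fun ρ hρ => ?_
  obtain ⟨⟨a, b⟩, c, d⟩ := hSi ρ hρ
  rw [rectIntegral_const_mul, rectIntegral_inv_sub a b c d]
  ring

/-! ### Backlund's bound for the variation of the argument -/

/-- At the height of `ρ` the integrand is real. At any other height the segment misses the cut of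
`log (z - ρ)`, and the integral's imaginary part is a difference of two principal arguments. -/
lemma abs_im_integral_inv_sub_le {x₀ x₁ y : ℝ} {ρ : ℂ} (hx : x₀ ≤ x₁)
    (h : ∀ x ∈ Icc x₀ x₁, (x + y * I : ℂ) ≠ ρ) :
    |(∫ x : ℝ in x₀..x₁, (x + y * I - ρ)⁻¹).im| ≤ 2 * Real.pi := by
  have hne : ∀ x ∈ uIcc x₀ x₁, (x + y * I - ρ : ℂ) ≠ 0 := fun x hx' => by
    rw [uIcc_of_le hx] at hx'
    exact sub_ne_zero.2 (h x hx')
  have hc : ContinuousOn (fun x : ℝ => (x + y * I - ρ : ℂ)⁻¹) (uIcc x₀ x₁) :=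
    ContinuousOn.inv₀ (by fun_prop) hne
  by_cases hy : y = ρ.im
  · have h0 : (∫ x : ℝ in x₀..x₁, (x + y * I - ρ)⁻¹).im = 0 := by
      have h1 := Complex.imCLM.intervalIntegral_comp_comm
        (hc.intervalIntegrable (μ := MeasureTheory.volume))
      simp only [imCLM_apply] at h1
      rw [← h1]
      simp [hy]
    rw [h0, abs_zero]
    positivity
  · have e := integral_horizontal_of_hasDerivAt (f := fun z => (z - ρ)⁻¹)
      (ℓ := fun z => log (z - ρ)) (a := x₀) (b := x₁) (y := y)
      (fun x _ => by
        simpa using ((hasDerivAt_id (x + y * I : ℂ)).sub_const ρ).clog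
          (Or.inr (by simpa [sub_eq_zero] using hy))) hc
    rw [e]
    simp only [sub_im, log_im]
    have a1 := abs_arg_le_pi (x₁ + y * I - ρ)
    have a2 := abs_arg_le_pi (x₀ + y * I - ρ)
    rw [abs_le] at *
    constructor <;> linarith

/-- A zero-free holomorphic function on a disc has a holomorphic logarithm there. -/
lemma exists_log_on_ball {G : ℂ → ℂ} {c : ℂ} {r : ℝ} (hr : 0 < r)
    (hG : DifferentiableOn ℂ G (Metric.ball c r)) (h0 : ∀ z ∈ Metric.ball c r, G z ≠ 0) :
    ∃ h : ℂ → ℂ, h c = 0 ∧ (∀ z ∈ Metric.ball c r, HasDerivAt h (logDeriv G z) z) ∧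
      ∀ z ∈ Metric.ball c r, G z = G c * exp (h z) := by
  have hcm : c ∈ Metric.ball c r := Metric.mem_ball_self hr
  obtain ⟨h, hhc, hh⟩ := ((differentiableOn_logDeriv Metric.isOpen_ball hG subset_rfl
    h0).isExactOn_ball).with_val_at c 0
  refine ⟨h, hhc, hh, fun z hz => ?_⟩
  have hd : ∀ w ∈ Metric.ball c r, HasDerivAt (fun w => G w * exp (-h w)) 0 w := by
    intro w hw
    have h1 := ((hG.differentiableAt (Metric.isOpen_ball.mem_nhds hw)).hasDerivAt).mul
      (hh w hw).neg.cexp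
    convert! h1 using 1
    have := h0 w hw
    rw [logDeriv_apply]
    field_simp
    ring
  have hconst := (convex_ball c r).is_const_of_fderivWithin_eq_zero (𝕜 := ℂ)
    (f := fun w => G w * exp (-h w))
    (fun w hw => (hd w hw).differentiableAt.differentiableWithinAt)
    (fun w hw => by
      rw [fderivWithin_of_isOpen Metric.isOpen_ball hw]
      ext
      simpa using (hd w hw).deriv) hz hcm
  simp only [hhc, neg_zero, exp_zero, mul_one] at hconst
  rw [← hconst, mul_assoc, ← exp_add]
  simp

/-- Backlund's bound for the variation of the argument of `F` along a horizontal segment close to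
`s₀`, in terms of the growth of `F` on a larger disc around `s₀`. -/
theorem abs_im_integral_logDeriv_le {F : ℂ → ℂ} {U : Set ℂ} {s₀ : ℂ} {r M : ℝ} (hU : IsOpen U)
    (hc : IsPreconnected U) (hF : DifferentiableOn ℂ F U) (hr : 0 < r)
    (hB : Metric.closedBall s₀ (6 * r) ⊆ U) (h0 : F s₀ ≠ 0)
    (hM : ∀ z ∈ Metric.closedBall s₀ (6 * r), ‖F z‖ ≤ M) {x₀ x₁ y : ℝ} (hx : x₀ ≤ x₁)
    (hseg : ∀ x ∈ Icc x₀ x₁, (x + y * I : ℂ) ∈ Metric.closedBall s₀ r)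
    (hne : ∀ x ∈ Icc x₀ x₁, F (x + y * I) ≠ 0) :
    |(∫ x : ℝ in x₀..x₁, logDeriv F (x + y * I)).im| ≤ 20 * (Real.log (M / ‖F s₀‖) + 1) := by
  have hs₀ : s₀ ∈ U := hB (Metric.mem_closedBall_self (by positivity))
  have h2B : Metric.closedBall s₀ (2 * r) ⊆ U :=
    (Metric.closedBall_subset_closedBall (by linarith)).trans hB
  have hfin := finite_zeros_of_isCompact hU hc hF hs₀ h0 (isCompact_closedBall s₀ (2 * r)) h2B
  set S := hfin.toFinset with hSdef
  have hSmem : ∀ z, z ∈ S ↔ z ∈ Metric.closedBall s₀ (2 * r) ∧ F z = 0 := fun z => by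
    simp [hSdef]
  obtain ⟨G, hG, hFG, hGS⟩ := exists_eq_prod_mul hU hF S (fun ρ hρ => h2B ((hSmem ρ).1 hρ).1)
    (fun ρ hρ => analyticOrderAt_ne_top_of_ne_zero hU hc hF hs₀ h0 (h2B ((hSmem ρ).1 hρ).1))
  set m : ℂ → ℕ := fun ρ => analyticOrderNatAt F ρ with hm
  set n : ℕ := ∑ ρ ∈ S, m ρ with hn
  have hG0 : ∀ z ∈ Metric.closedBall s₀ (2 * r), G z ≠ 0 := by
    intro z hz hz0
    by_cases hzS : z ∈ S
    · exact hGS z hzS hz0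
    · exact hzS ((hSmem z).2 ⟨hz, by rw [hFG z, hz0, mul_zero]⟩)
  have hF0 : 0 < ‖F s₀‖ := norm_pos_iff.2 h0
  have hMF : ‖F s₀‖ ≤ M := hM _ (Metric.mem_closedBall_self (by positivity))
  have hM0 : 0 < M := hF0.trans_le hMF
  -- bounds for the polynomial factor
  have hPlow : ∀ z ∈ Metric.sphere s₀ (6 * r), (4 * r) ^ n ≤ ‖∏ ρ ∈ S, (z - ρ) ^ m ρ‖ := by
    intro z hz
    rw [norm_prod, hn, ← Finset.prod_pow_eq_pow_sum]
    refine Finset.prod_le_prod (fun _ _ => by positivity) fun ρ hρ => ?_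
    rw [norm_pow]
    refine pow_le_pow_left₀ (by positivity) ?_ _
    have h1 := ((hSmem ρ).1 hρ).1
    rw [mem_closedBall_iff_norm] at h1
    rw [mem_sphere_iff_norm] at hz
    have h2 := norm_sub_norm_le (z - s₀) (ρ - s₀)
    rw [sub_sub_sub_cancel_right] at h2
    linarith
  have hPup : ‖∏ ρ ∈ S, (s₀ - ρ) ^ m ρ‖ ≤ (2 * r) ^ n := by
    rw [norm_prod, hn, ← Finset.prod_pow_eq_pow_sum]
    refine Finset.prod_le_prod (fun _ _ => by positivity) fun ρ hρ => ?_
    rw [norm_pow]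
    refine pow_le_pow_left₀ (norm_nonneg _) ?_ _
    have h1 := ((hSmem ρ).1 hρ).1
    rw [mem_closedBall_iff_norm] at h1
    rwa [norm_sub_rev]
  have hGup : ∀ z ∈ Metric.closedBall s₀ (6 * r), ‖G z‖ ≤ M / (4 * r) ^ n := by
    intro z hz
    have hcl : closure (Metric.ball s₀ (6 * r)) = Metric.closedBall s₀ (6 * r) :=
      closure_ball s₀ (by positivity)
    refine norm_le_of_forall_mem_frontier_norm_le (U := Metric.ball s₀ (6 * r))
      Metric.isBounded_ball ?_ (fun w hw => ?_) (by rwa [hcl])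
    · exact (hG.mono (by rw [hcl]; exact hB)).diffContOnCl
    · rw [frontier_ball s₀ (by positivity)] at hw
      have h1 := hM w (Metric.sphere_subset_closedBall hw)
      rw [hFG w, norm_mul] at h1
      rw [le_div_iff₀ (by positivity), mul_comm]
      exact (mul_le_mul_of_nonneg_right (hPlow w hw) (norm_nonneg _)).trans h1
  have hGlow : ‖F s₀‖ / (2 * r) ^ n ≤ ‖G s₀‖ := by
    rw [div_le_iff₀ (by positivity), hFG s₀, norm_mul, mul_comm]
    exact mul_le_mul_of_nonneg_left hPup (norm_nonneg _)
  set L := Real.log (M / ‖F s₀‖) with hL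
  -- Each zero within `2r` of `s₀` contributes a factor at least `4r` on the outer circle and at
  -- most `2r` at the centre, so dividing the `n` zeros out gains `2 ^ n`. At `z = s₀` this becomes
  -- a Jensen-type bound `n log 2 ≤ L`.
  have hratio : ∀ z ∈ Metric.closedBall s₀ (6 * r), ‖G z‖ / ‖G s₀‖ ≤ M / ‖F s₀‖ / 2 ^ n := by
    intro z hz
    have hpos : 0 < ‖F s₀‖ / (2 * r) ^ n := by positivity
    calc ‖G z‖ / ‖G s₀‖ ≤ (M / (4 * r) ^ n) / (‖F s₀‖ / (2 * r) ^ n) :=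
          div_le_div₀ (by positivity) (hGup z hz) hpos hGlow
      _ = M / ‖F s₀‖ / 2 ^ n := by
          rw [show 4 * r = 2 * (2 * r) by ring, mul_pow 2 (2 * r)]
          field_simp
  have hGs₀ : 0 < ‖G s₀‖ := norm_pos_iff.2 (hG0 _ (Metric.mem_closedBall_self (by positivity)))
  have hnL : n * Real.log 2 ≤ L := by
    have h1 := hratio s₀ (Metric.mem_closedBall_self (by positivity))
    rw [div_self hGs₀.ne', le_div_iff₀ (by positivity), one_mul] at h1
    rw [← Real.log_pow]
    exact Real.log_le_log (by positivity) h1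
  have hL0 : 0 ≤ L := le_trans (by positivity) hnL
  -- the zero-free factor
  have hball : Metric.ball s₀ (2 * r) ⊆ Metric.closedBall s₀ (2 * r) :=
    Metric.ball_subset_closedBall
  obtain ⟨h, hhc, hh, hGh⟩ := exists_log_on_ball (by positivity : 0 < 2 * r)
    (hG.mono (hball.trans h2B)) fun z hz => hG0 z (hball hz)
  have hre : ∀ z ∈ Metric.ball s₀ (2 * r), (h z).re ≤ L + 1 := by
    intro z hz
    have h1 := hratio z (Metric.closedBall_subset_closedBall (by linarith) (hball hz))
    rw [hGh z hz, norm_mul, mul_div_cancel_left₀ _ hGs₀.ne', norm_exp] at h1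
    have h2 : Real.exp (h z).re ≤ M / ‖F s₀‖ := h1.trans
      (div_le_self (by positivity) (one_le_pow₀ (by norm_num)))
    have h3 := (Real.le_log_iff_exp_le (by positivity)).2 h2
    linarith
  -- Borel–Carathéodory from radius `2r` to radius `r`; `L + 1` replaces `L` because the bound on
  -- the real part must be strictly positive.
  have hbc : ∀ z ∈ Metric.closedBall s₀ r, ‖h z‖ ≤ 2 * (L + 1) := by
    intro z hz
    rw [mem_closedBall_iff_norm] at hz
    have hmaps : ∀ w ∈ Metric.ball (0 : ℂ) (2 * r), s₀ + w ∈ Metric.ball s₀ (2 * r) := by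
      intro w hw
      simpa using hw
    have h1 := borelCaratheodory_zero (f := fun w => h (s₀ + w)) (M := L + 1) (R := 2 * r)
      (z := z - s₀) (by linarith)
      (fun w hw => by
        have h1 : DifferentiableAt ℂ h (s₀ + w) := (hh _ (hmaps w hw)).differentiableAt
        have h2 : DifferentiableAt ℂ (fun w => s₀ + w) w := by fun_prop
        exact (h1.comp w h2).differentiableWithinAt)
      (fun w hw => hre _ (hmaps w hw)) (by positivity)
      (by rw [mem_ball_zero_iff]; linarith) (by simpa using hhc)
    simp only [add_sub_cancel] at h1
    refine h1.trans ?_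
    rw [div_le_iff₀ (by linarith)]
    nlinarith
  -- put the factors together
  have hseg2 : ∀ x ∈ uIcc x₀ x₁, (x + y * I : ℂ) ∈ Metric.ball s₀ (2 * r) := fun x hx' => by
    rw [uIcc_of_le hx] at hx'
    exact Metric.closedBall_subset_ball (by linarith) (hseg x hx')
  have hsegS : ∀ x ∈ uIcc x₀ x₁, (x + y * I : ℂ) ∉ S := fun x hx' hS => by
    rw [uIcc_of_le hx] at hx'
    exact hne x hx' ((hSmem _).1 hS).2
  have hinvc : ∀ ρ ∈ S, ContinuousOn (fun x : ℝ => (m ρ : ℂ) * (x + y * I - ρ)⁻¹)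
      (uIcc x₀ x₁) := by
    intro ρ hρ
    refine continuousOn_const.mul (ContinuousOn.inv₀ (by fun_prop) fun x hx' h => ?_)
    rw [sub_eq_zero] at h
    exact hsegS x hx' (h ▸ hρ)
  have hGc : ContinuousOn (fun x : ℝ => logDeriv G (x + y * I)) (uIcc x₀ x₁) := by
    have h1 := continuousOn_logDeriv hU hG (hball.trans h2B) fun z hz => hG0 z (hball hz)
    exact h1.comp (f := fun x : ℝ => (x + y * I : ℂ)) (by fun_prop) hseg2
  have hcongr : ∫ x : ℝ in x₀..x₁, logDeriv F (x + y * I) =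
      ∫ x : ℝ in x₀..x₁, (∑ ρ ∈ S, (m ρ : ℂ) * (x + y * I - ρ)⁻¹ + logDeriv G (x + y * I)) :=
    intervalIntegral.integral_congr fun x hx' =>
      logDeriv_eq_sum_add hU hG hFG (h2B (hball (hseg2 x hx'))) (hsegS x hx')
        (hG0 _ (hball (hseg2 x hx')))
  rw [hcongr, intervalIntegral.integral_add (continuousOn_finsetSum _ hinvc).intervalIntegrable
    hGc.intervalIntegrable, intervalIntegral.integral_finsetSum
    (fun ρ hρ => (hinvc ρ hρ).intervalIntegrable),
    integral_horizontal_of_hasDerivAt (fun x hx' => hh _ (hseg2 x hx')) hGc]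
  simp only [intervalIntegral.integral_const_mul, add_im, im_sum]
  have hsum : |∑ ρ ∈ S, ((m ρ : ℂ) * ∫ x : ℝ in x₀..x₁, (x + y * I - ρ)⁻¹).im| ≤
      n * (2 * Real.pi) := by
    rw [hn, Nat.cast_sum, Finset.sum_mul]
    refine (Finset.abs_sum_le_sum_abs _ _).trans (Finset.sum_le_sum fun ρ hρ => ?_)
    rw [← ofReal_natCast, im_ofReal_mul, abs_mul, Nat.abs_cast]
    refine mul_le_mul_of_nonneg_left (abs_im_integral_inv_sub_le hx fun x hx' h => ?_)
      (by positivity)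
    exact hsegS x (by rwa [uIcc_of_le hx]) (h ▸ hρ)
  have he : ∀ x ∈ Icc x₀ x₁, |(h (x + y * I)).im| ≤ 2 * (L + 1) := fun x hx' =>
    (abs_im_le_norm _).trans (hbc _ (hseg x hx'))
  have he0 := he x₀ (left_mem_Icc.2 hx)
  have he1 := he x₁ (right_mem_Icc.2 hx)
  -- Here `2π / log 2 < 16`. The zeros cost at most `16 L` and the two endpoint values of `h` at
  -- most `4 (L + 1)`, which fits in `20 (L + 1)`.
  have hpi : n * (2 * Real.pi) ≤ 16 * L := by
    have h1 := Real.log_two_gt_d9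
    have h2 := Real.pi_lt_d2
    have h3 : (0 : ℝ) ≤ n := Nat.cast_nonneg n
    nlinarith
  rw [sub_im]
  rw [abs_le] at *
  constructor <;> linarith

/-! ### Stirling's formula through Gudermann's series -/

/-- The general term of Gudermann's series for the remainder in Stirling's formula. -/
noncomputable def gudermannTerm (w : ℂ) : ℂ := (w + 1 / 2) * log (1 + w⁻¹) - 1

lemma norm_inv_lt_half {w : ℂ} (hw : 2 < w.re) : ‖w⁻¹‖ < 1 / 2 := by
  have h1 : 2 < ‖w‖ := hw.trans_le (re_le_norm w)
  rw [norm_inv, one_div]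
  exact inv_strictAnti₀ (by norm_num) h1

/-- With `z = 1/w`, the shift by `1/2` cancels the terms of order `z`: `(w + 1/2)(z - z²/2) - 1 =
-z²/4`. Only the Taylor remainder of the logarithm is left to estimate. -/
lemma norm_gudermannTerm_le {w : ℂ} (hw : 2 < w.re) : ‖gudermannTerm w‖ ≤ 2 * ‖w⁻¹‖ ^ 2 := by
  have hz := norm_inv_lt_half hw
  have hw0 : w ≠ 0 := by rintro rfl; norm_num at hw
  set z := w⁻¹ with hzdef
  have hwz : w * z = 1 := mul_inv_cancel₀ hw0
  have hr := norm_log_sub_logTaylor_le 2 (hz.trans (by norm_num) : ‖z‖ < 1)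
  have ht : logTaylor (2 + 1) z = z - z ^ 2 / 2 := by
    simp [logTaylor_succ, logTaylor_zero]; ring
  rw [ht] at hr
  set e := log (1 + z) - (z - z ^ 2 / 2) with he
  have hb : gudermannTerm w = -(1 / 4) * z ^ 2 + (w + 1 / 2) * e := by
    rw [gudermannTerm, ← hzdef, he]
    linear_combination (1 - z / 2) * hwz
  have he' : ‖e‖ ≤ ‖z‖ ^ 3 := by
    refine hr.trans ?_
    have h1 : (1 - ‖z‖)⁻¹ ≤ 2 := by
      rw [inv_le_comm₀ (by linarith) (by norm_num)]; linarith
    have h2 : 0 ≤ ‖z‖ ^ 3 := by positivity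
    norm_num
    nlinarith
  have hwe : ‖(w + 1 / 2) * e‖ ≤ (5 / 4) * ‖z‖ ^ 2 := by
    rw [norm_mul]
    have h1 : ‖w + 1 / 2‖ ≤ ‖w‖ + 1 / 2 := (norm_add_le _ _).trans (by norm_num)
    have h2 : ‖w‖ * ‖z‖ = 1 := by rw [← norm_mul, hwz, norm_one]
    calc ‖w + 1 / 2‖ * ‖e‖ ≤ (‖w‖ + 1 / 2) * ‖z‖ ^ 3 := by gcongr
      _ = (‖w‖ * ‖z‖) * ‖z‖ ^ 2 + 1 / 2 * ‖z‖ * ‖z‖ ^ 2 := by ring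
      _ ≤ (5 / 4) * ‖z‖ ^ 2 := by
        rw [h2]; nlinarith [norm_nonneg z, sq_nonneg ‖z‖]
  rw [hb]
  refine (norm_add_le _ _).trans ?_
  have : ‖-(1 / 4) * z ^ 2‖ = 1 / 4 * ‖z‖ ^ 2 := by
    rw [norm_mul, norm_pow]; norm_num
  rw [this]
  nlinarith [sq_nonneg ‖z‖]

lemma norm_gudermannTerm_add_natCast_le {s : ℂ} (hs : 2 < s.re) (n : ℕ) :
    ‖gudermannTerm (s + n)‖ ≤ 2 * (1 / ((n + 1 : ℕ) : ℝ) ^ 2) := by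
  have hw : 2 < (s + n).re := by simp; linarith [Nat.cast_nonneg (α := ℝ) n]
  refine (norm_gudermannTerm_le hw).trans ?_
  gcongr
  rw [norm_inv, inv_pow, ← one_div]
  refine one_div_le_one_div_of_le (by positivity) (pow_le_pow_left₀ (by positivity) ?_ _)
  refine le_trans ?_ (re_le_norm _)
  simp; linarith

lemma log_add_one_sub_log {w : ℂ} (hw : 0 < w.re) : log (w + 1) - log w = log (1 + w⁻¹) := by
  have hw0 : w ≠ 0 := by rintro rfl; simp at hw
  have hi : 0 < (1 + w⁻¹).re := by
    simp only [add_re, one_re, inv_re]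
    have := div_nonneg hw.le (normSq_nonneg w)
    linarith
  have hi0 : 1 + w⁻¹ ≠ 0 := fun h => by rw [h] at hi; simp at hi
  have h1 := abs_lt.1 (abs_arg_lt_pi_div_two_iff.2 (Or.inl hw))
  have h2 := abs_lt.1 (abs_arg_lt_pi_div_two_iff.2 (Or.inl hi))
  have h3 : w + 1 = w * (1 + w⁻¹) := by field_simp
  rw [h3, log_mul hw0 hi0 ⟨by linarith, by linarith⟩]
  ring

lemma sum_gudermannTerm {s : ℂ} (hs : 0 < s.re) (n : ℕ) :
    ∑ j ∈ Finset.range n, gudermannTerm (s + j) =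
      (s + n - 1 / 2) * log (s + n) - (s - 1 / 2) * log s -
        ∑ j ∈ Finset.range n, log (s + j) - n := by
  induction n with
  | zero => simp
  | succ n ih =>
    have hw : 0 < (s + n).re := by simp; linarith [Nat.cast_nonneg (α := ℝ) n]
    rw [Finset.sum_range_succ, Finset.sum_range_succ, ih, gudermannTerm, ← log_add_one_sub_log hw]
    push_cast
    ring_nf

lemma factorial_eq_stirlingSeq_mul {n : ℕ} (hn : n ≠ 0) :
    (n.factorial : ℂ) = Stirling.stirlingSeq n * √2 * exp ((n + 1 / 2) * Real.log n - n) := by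
  have hn' : (0 : ℝ) < n := by positivity
  have h : (n.factorial : ℝ) =
      Stirling.stirlingSeq n * √2 * Real.exp ((n + 1 / 2) * Real.log n - n) := by
    have h0 : 1 / 2 * Real.log n = Real.log √n := by rw [Real.log_sqrt hn'.le]; ring
    have h1 : Real.exp ((n + 1 / 2) * Real.log n - n) = √n * (n / Real.exp 1) ^ n := by
      rw [div_pow, ← Real.exp_nat_mul, mul_one, Real.exp_sub, add_mul, Real.exp_add,
        Real.exp_nat_mul, Real.exp_log hn', h0, Real.exp_log (by positivity)]
      ring
    rw [h1, Stirling.stirlingSeq, Real.sqrt_mul (by norm_num)]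
    field_simp
  rw [← ofReal_natCast, h]
  push_cast
  ring_nf

/-- Insert `stirlingSeq` for the factorial in Euler's limit formula and sum the logarithms of `s +
j` by `sum_gudermannTerm`. All terms in `log n` cancel exactly, so each piece of the exponent has a
limit. -/
lemma GammaSeq_eq {s : ℂ} (hs : 0 < s.re) {n : ℕ} (hn : n ≠ 0) :
    GammaSeq s n = Stirling.stirlingSeq n * √2 *
      exp (1 - (s + n + 1 / 2) * log (1 + (s + 1) / n) + (s - 1 / 2) * log s +
        ∑ j ∈ Finset.range (n + 1), gudermannTerm (s + j)) := by
  have hn' : (0 : ℝ) < n := by positivity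
  have hre : ∀ j : ℕ, 0 < (s + j).re := fun j => by
    simp; linarith [Nat.cast_nonneg (α := ℝ) j]
  have hne : ∀ j : ℕ, s + j ≠ 0 := fun j h => by have := hre j; rw [h] at this; simp at this
  have hprod : ∏ j ∈ Finset.range (n + 1), (s + j) =
      exp (∑ j ∈ Finset.range (n + 1), log (s + j)) := by
    rw [exp_sum]
    exact Finset.prod_congr rfl fun j _ => (exp_log (hne j)).symm
  have hlog : log (s + (n + 1 : ℕ)) = Real.log n + log (1 + (s + 1) / n) := by
    rw [← log_ofReal_mul hn']
    · congr 1
      push_cast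
      field_simp
      ring
    · intro h
      apply hne (n + 1)
      have : (n : ℂ) ≠ 0 := by exact_mod_cast hn
      field_simp at h
      push_cast
      linear_combination h
  rw [GammaSeq, hprod, cpow_def_of_ne_zero (by exact_mod_cast hn), factorial_eq_stirlingSeq_mul hn,
    sum_gudermannTerm hs, hlog, natCast_log, div_eq_mul_inv, ← exp_neg,
    show ∀ a b c d e : ℂ, a * (b * c * d) * e = b * c * (a * d * e) by intros; ring,
    ← exp_add, ← exp_add]
  congr 2
  push_cast
  ring

/-- Stirling's formula in the half-plane `2 < re s`, with holomorphic bounded remainder. -/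
theorem exists_Gamma_eq_exp : ∃ (E : ℂ → ℂ) (C : ℝ), DifferentiableOn ℂ E {s | 2 < s.re} ∧
    (∀ s : ℂ, 2 < s.re → ‖E s‖ ≤ C) ∧
    ∀ s : ℂ, 2 < s.re → Gamma s = exp ((s - 1 / 2) * log s - s + E s) := by
  have hsum : Summable fun n : ℕ => 2 * (1 / ((n + 1 : ℕ) : ℝ) ^ 2) :=
    ((summable_nat_add_iff (f := fun n : ℕ => 1 / (n : ℝ) ^ 2) 1).2
      (Real.summable_one_div_nat_pow.2 one_lt_two)).mul_left 2
  have hopen : IsOpen {s : ℂ | 2 < s.re} := isOpen_lt continuous_const continuous_re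
  have hd : DifferentiableOn ℂ (fun s => ∑' n : ℕ, gudermannTerm (s + n)) {s | 2 < s.re} := by
    refine differentiableOn_tsum_of_summable_norm hsum (fun n s hs => ?_) hopen
      fun n s hs => norm_gudermannTerm_add_natCast_le hs n
    have hw : 2 < (s + n).re := by
      have : (2 : ℝ) < s.re := hs
      simp; linarith [Nat.cast_nonneg (α := ℝ) n]
    have hw0 : s + n ≠ 0 := fun h => by rw [h] at hw; norm_num at hw
    have hsl : 1 + (s + n)⁻¹ ∈ slitPlane :=
      mem_slitPlane_of_norm_lt_one ((norm_inv_lt_half hw).trans (by norm_num))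
    unfold gudermannTerm
    refine DifferentiableAt.differentiableWithinAt ?_
    have h1 : DifferentiableAt ℂ (fun s : ℂ => 1 + (s + n)⁻¹) s :=
      (DifferentiableAt.fun_inv (h := fun s : ℂ => s + n) (by fun_prop) hw0).const_add 1
    exact (DifferentiableAt.mul (by fun_prop) (h1.clog hsl)).sub_const 1
  -- The constant `√(2π)` is the limit `√π` of `stirlingSeq` times `√2`; its logarithm is put into
  -- the remainder.
  refine ⟨fun s => ∑' n : ℕ, gudermannTerm (s + n) + log (√(2 * Real.pi) : ℝ),
    ∑' n : ℕ, 2 * (1 / ((n + 1 : ℕ) : ℝ) ^ 2) + ‖log (√(2 * Real.pi) : ℝ)‖,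
    hd.add_const _, fun s hs => ?_, fun s hs => ?_⟩
  · exact (norm_add_le _ _).trans (add_le_add_left
      (tsum_of_norm_bounded hsum.hasSum (norm_gudermannTerm_add_natCast_le hs)) _)
  · have hs0 : 0 < s.re := by linarith
    have hS : Summable fun n : ℕ => gudermannTerm (s + n) :=
      Summable.of_norm_bounded hsum (norm_gudermannTerm_add_natCast_le hs)
    have hlim := hS.hasSum.tendsto_sum_nat.comp (tendsto_add_atTop_nat 1)
    have hn1 : Tendsto (fun n : ℕ => (n : ℂ) * ((s + 1) / n)) atTop (𝓝 (s + 1)) := by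
      refine tendsto_const_nhds.congr' ?_
      filter_upwards [eventually_ne_atTop 0] with n hn
      have : (n : ℂ) ≠ 0 := by exact_mod_cast hn
      field_simp
    have hl1 := tendsto_nat_mul_log_one_add_of_tendsto hn1
    have hl2 : Tendsto (fun n : ℕ => log (1 + (s + 1) / n)) atTop (𝓝 0) := by
      have h1 : Tendsto (fun n : ℕ => 1 + (s + 1) / (n : ℂ)) atTop (𝓝 (1 + (s + 1) * 0)) := by
        refine tendsto_const_nhds.add ?_
        simp only [div_eq_mul_inv]
        exact tendsto_const_nhds.mul (tendsto_inv_atTop_nhds_zero_nat (𝕜 := ℂ))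
      rw [mul_zero, add_zero] at h1
      have h2 := h1.clog one_mem_slitPlane
      rwa [log_one] at h2
    have hexp : Tendsto (fun n : ℕ => 1 - (s + n + 1 / 2) * log (1 + (s + 1) / n) +
        (s - 1 / 2) * log s + ∑ j ∈ Finset.range (n + 1), gudermannTerm (s + j)) atTop
        (𝓝 (-s + (s - 1 / 2) * log s + ∑' n : ℕ, gudermannTerm (s + n))) := by
      have h1 := (((tendsto_const_nhds (x := (1 : ℂ))).sub
        (hl1.add (hl2.const_mul (s + 1 / 2)))).add_const ((s - 1 / 2) * log s)).add hlim
      convert! h1 using 2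
      · simp only [Function.comp_apply]; ring
      · ring
    have hst : Tendsto (fun n => (Stirling.stirlingSeq n : ℂ)) atTop (𝓝 (√Real.pi : ℝ)) :=
      (continuous_ofReal.tendsto _).comp Stirling.tendsto_stirlingSeq_sqrt_pi
    have hfin := (hst.mul_const ((√2 : ℝ) : ℂ)).mul ((continuous_exp.tendsto _).comp hexp)
    have hG := (GammaSeq_tendsto_Gamma s).congr' (by
      filter_upwards [eventually_ne_atTop 0] with n hn using GammaSeq_eq hs0 hn)
    rw [tendsto_nhds_unique hG hfin]
    have hpi : (√(2 * Real.pi) : ℝ) = √Real.pi * √2 := by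
      rw [mul_comm, Real.sqrt_mul Real.pi_pos.le]
    have hne : ((√(2 * Real.pi) : ℝ) : ℂ) ≠ 0 := by
      rw [ofReal_ne_zero]; positivity
    rw [← add_assoc, exp_add _ (log _), exp_log hne, hpi]
    push_cast
    rw [mul_comm]
    congr 2
    ring

/-! ### The zeta function to the right of the imaginary axis -/

/-- The general term of the series of `(s - 1) * ζ(s) - 1`, which converges for `0 < re s`. -/
noncomputable def zetaTerm (n : ℕ) (s : ℂ) : ℂ :=
  (s - 1) * ((n + 1 : ℝ) : ℂ) ^ (-s) +
    (((n + 2 : ℝ) : ℂ) ^ (1 - s) - ((n + 1 : ℝ) : ℂ) ^ (1 - s))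

lemma hasDerivAt_ofReal_cpow {x : ℝ} (hx : 0 < x) (r : ℂ) :
    HasDerivAt (fun x : ℝ => (x : ℂ) ^ r) (r * (x : ℂ) ^ (r - 1)) x := by
  simpa using ((hasDerivAt_id (x : ℂ)).cpow_const (c := r)
    (ofReal_mem_slitPlane.2 hx)).comp_ofReal

lemma norm_cpow_sub_cpow_le {s : ℂ} (hs : 0 < s.re) {N x : ℝ} (hN : 0 < N)
    (hx : x ∈ Icc N (N + 1)) :
    ‖(x : ℂ) ^ (-s) - (N : ℂ) ^ (-s)‖ ≤ ‖s‖ * N ^ (-s.re - 1) := by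
  have h := norm_image_sub_le_of_norm_deriv_le_segment' (f := fun x : ℝ => (x : ℂ) ^ (-s))
    (f' := fun x => -s * (x : ℂ) ^ (-s - 1)) (C := ‖s‖ * N ^ (-s.re - 1)) (a := N) (b := N + 1)
    (fun x hx => (hasDerivAt_ofReal_cpow (hN.trans_le hx.1) _).hasDerivWithinAt)
    (fun x hx => by
      rw [norm_mul, norm_neg, norm_cpow_eq_rpow_re_of_pos (hN.trans_le hx.1)]
      refine mul_le_mul_of_nonneg_left ?_ (norm_nonneg _)
      simp only [sub_re, neg_re, one_re]
      exact Real.rpow_le_rpow_of_nonpos hN hx.1 (by linarith)) x hx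
  refine h.trans (mul_le_of_le_one_right (by positivity) (by linarith [hx.2]))

/-- With `N = n + 1`, the term is the increment over `[N, N + 1]` of `(s - 1) N⁻ˢ x + x¹⁻ˢ`, whose
derivative `(s - 1)(N⁻ˢ - x⁻ˢ)` is small by a second use of the mean value inequality. -/
lemma norm_zetaTerm_le {s : ℂ} (hs : 0 < s.re) (n : ℕ) :
    ‖zetaTerm n s‖ ≤ ‖s - 1‖ * ‖s‖ * ((n + 1 : ℝ)) ^ (-s.re - 1) := by
  have hN : (0 : ℝ) < n + 1 := by positivity
  set N : ℝ := n + 1 with hNdef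
  have h := norm_image_sub_le_of_norm_deriv_le_segment'
    (f := fun x : ℝ => (s - 1) * (N : ℂ) ^ (-s) * x + (x : ℂ) ^ (1 - s))
    (f' := fun x => (s - 1) * ((N : ℂ) ^ (-s) - (x : ℂ) ^ (-s)))
    (C := ‖s - 1‖ * ‖s‖ * N ^ (-s.re - 1)) (a := N) (b := N + 1)
    (fun x hx => by
      have h1 := (hasDerivAt_ofReal_cpow (hN.trans_le hx.1) (1 - s))
      have h2 : HasDerivAt (fun x : ℝ => (s - 1) * (N : ℂ) ^ (-s) * x)
          ((s - 1) * (N : ℂ) ^ (-s) * 1) x :=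
        (Complex.ofRealCLM.hasDerivAt (x := x)).const_mul _
      convert! (h2.add h1).hasDerivWithinAt using 1
      rw [show 1 - s - 1 = -s by ring]
      ring)
    (fun x hx => by
      rw [norm_mul, mul_assoc, norm_sub_rev ((N : ℂ) ^ (-s))]
      exact mul_le_mul_of_nonneg_left
        (norm_cpow_sub_cpow_le hs hN (Ico_subset_Icc_self hx)) (norm_nonneg _))
    (N + 1) ⟨by linarith, le_rfl⟩
  rw [add_sub_cancel_left, mul_one] at h
  convert! h using 2
  rw [zetaTerm, show (n + 2 : ℝ) = N + 1 by rw [hNdef]; ring, ← hNdef]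
  push_cast
  ring

lemma summable_natCast_add_one_rpow {p : ℝ} (hp : 1 < p) :
    Summable fun n : ℕ => (n + 1 : ℝ) ^ (-p) := by
  have := (summable_nat_add_iff (f := fun n : ℕ => (n : ℝ) ^ (-p)) 1).2
    (Real.summable_nat_rpow.2 (by linarith))
  simpa using this

lemma differentiableOn_tsum_zetaTerm :
    DifferentiableOn ℂ (fun s => ∑' n : ℕ, zetaTerm n s) {s | 0 < s.re} := by
  intro s hs
  have hs : 0 < s.re := hs
  set V : Set ℂ := {w | s.re / 2 < w.re} ∩ Metric.ball 0 (‖s‖ + 1) with hV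
  have hVo : IsOpen V := (isOpen_lt continuous_const continuous_re).inter Metric.isOpen_ball
  have hsV : s ∈ V := ⟨by show s.re / 2 < s.re; linarith, by simp⟩
  have hsum : Summable fun n : ℕ =>
      (‖s‖ + 2) * (‖s‖ + 1) * (n + 1 : ℝ) ^ (-(s.re / 2 + 1)) :=
    (summable_natCast_add_one_rpow (by linarith)).mul_left _
  have hd : DifferentiableOn ℂ (fun s => ∑' n : ℕ, zetaTerm n s) V := by
    refine differentiableOn_tsum_of_summable_norm hsum (fun n w hw => ?_) hVo fun n w hw => ?_
    · have h1 : ((n + 1 : ℝ) : ℂ) ≠ 0 := by rw [ofReal_ne_zero]; positivity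
      have h2 : ((n + 2 : ℝ) : ℂ) ≠ 0 := by rw [ofReal_ne_zero]; positivity
      unfold zetaTerm
      refine DifferentiableAt.differentiableWithinAt ?_
      refine DifferentiableAt.add (DifferentiableAt.mul (by fun_prop) ?_)
        (DifferentiableAt.sub ?_ ?_)
      · exact DifferentiableAt.const_cpow (by fun_prop) (Or.inl h1)
      · exact DifferentiableAt.const_cpow (by fun_prop) (Or.inl h2)
      · exact DifferentiableAt.const_cpow (by fun_prop) (Or.inl h1)
    · have hw1 : s.re / 2 < w.re := hw.1
      have hw2 : ‖w‖ < ‖s‖ + 1 := by simpa using hw.2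
      refine (norm_zetaTerm_le (by linarith) n).trans ?_
      have h3 : ‖w - 1‖ ≤ ‖s‖ + 2 := (norm_sub_le _ _).trans (by rw [norm_one]; linarith)
      have h4 : (n + 1 : ℝ) ^ (-w.re - 1) ≤ (n + 1 : ℝ) ^ (-(s.re / 2 + 1)) :=
        Real.rpow_le_rpow_of_exponent_le (by linarith [Nat.cast_nonneg (α := ℝ) n]) (by linarith)
      gcongr
  exact (hd.differentiableAt (hVo.mem_nhds hsV)).differentiableWithinAt

lemma sub_one_mul_riemannZeta_of_one_lt_re {s : ℂ} (hs : 1 < s.re) :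
    (s - 1) * riemannZeta s = 1 + ∑' n : ℕ, zetaTerm n s := by
  have hs0 : 0 < s.re := by linarith
  have hS : Summable fun n : ℕ => zetaTerm n s := by
    refine Summable.of_norm_bounded ((summable_natCast_add_one_rpow
      (p := s.re + 1) (by linarith)).mul_left (‖s - 1‖ * ‖s‖)) fun n => ?_
    convert! norm_zetaTerm_le hs0 n using 3
    ring
  have h1 := hS.hasSum.tendsto_sum_nat
  have hz : HasSum (fun n : ℕ => ((n + 1 : ℝ) : ℂ) ^ (-s)) (riemannZeta s) := by
    rw [zeta_eq_tsum_one_div_nat_add_one_cpow hs]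
    have h2 := (summable_nat_add_iff 1).2 (summable_one_div_nat_cpow.2 hs)
    have h3 := h2.hasSum
    push_cast at h3
    convert! h3 using 2 with n
    push_cast
    rw [cpow_neg, one_div]
  have ht : Tendsto (fun n : ℕ => ((n + 1 : ℝ) : ℂ) ^ (1 - s)) atTop (𝓝 0) := by
    rw [tendsto_zero_iff_norm_tendsto_zero]
    have h2 : Tendsto (fun n : ℕ => (n + 1 : ℝ) ^ (-(s.re - 1))) atTop (𝓝 0) :=
      (tendsto_rpow_neg_atTop (by linarith)).comp
        (tendsto_atTop_add_const_right _ 1 tendsto_natCast_atTop_atTop)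
    refine h2.congr fun n => ?_
    rw [norm_cpow_eq_rpow_re_of_pos (by positivity)]
    simp
  -- The differences of the powers with exponent `1 - s` telescope, with limit `0 - 1`.
  have h2 : Tendsto (fun N => ∑ n ∈ Finset.range N, zetaTerm n s) atTop
      (𝓝 ((s - 1) * riemannZeta s + (0 - 1))) := by
    have h3 := ((hz.tendsto_sum_nat).const_mul (s - 1)).add (ht.sub_const 1)
    refine h3.congr fun N => ?_
    have h4 := Finset.sum_range_sub (fun n : ℕ => ((n + 1 : ℝ) : ℂ) ^ (1 - s)) N
    simp only [zetaTerm, Finset.sum_add_distrib, Finset.mul_sum]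
    congr 1
    convert! h4.symm using 2
    · simp
    · push_cast
      ring_nf
  rw [tendsto_nhds_unique h1 h2]
  ring

/-- Identity theorem from a neighbourhood of `2`, with the entire function `riemannZeta₁` standing
for the left-hand side. -/
lemma sub_one_mul_riemannZeta {s : ℂ} (hs : 0 < s.re) (hs1 : s ≠ 1) :
    (s - 1) * riemannZeta s = 1 + ∑' n : ℕ, zetaTerm n s := by
  have hopen : IsOpen {s : ℂ | 0 < s.re} := isOpen_lt continuous_const continuous_re
  have hone : ∀ {s : ℂ}, s ≠ 1 → riemannZeta₁ s = (s - 1) * riemannZeta s := fun {s} h => by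
    rw [riemannZeta_eq_inv_sub_mul h, mul_inv_cancel_left₀ (sub_ne_zero.2 h)]
  have h1 : AnalyticOnNhd ℂ riemannZeta₁ {s | 0 < s.re} :=
    differentiable_riemannZeta₁.differentiableOn.analyticOnNhd hopen
  have h2 : AnalyticOnNhd ℂ (fun s => 1 + ∑' n : ℕ, zetaTerm n s) {s | 0 < s.re} :=
    (differentiableOn_tsum_zetaTerm.const_add 1).analyticOnNhd hopen
  have h3 : riemannZeta₁ =ᶠ[𝓝 2] fun s => 1 + ∑' n : ℕ, zetaTerm n s := by
    have : {s : ℂ | 1 < s.re} ∈ 𝓝 (2 : ℂ) :=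
      (isOpen_lt continuous_const continuous_re).mem_nhds (by simp)
    filter_upwards [this] with s hs
    rw [hone (by rintro rfl; simp at hs), sub_one_mul_riemannZeta_of_one_lt_re hs]
  have h4 := h1.eqOn_of_preconnected_of_eventuallyEq h2
    (convex_halfSpace_re_gt 0).isPreconnected (by simp) h3 hs
  rw [← hone hs1]
  exact h4

theorem exists_norm_riemannZeta_le : ∃ C : ℝ, 0 ≤ C ∧ ∀ s : ℂ, 1 / 2 ≤ s.re → 1 / 4 ≤ |s.im| →
    ‖riemannZeta s‖ ≤ C * (1 + ‖s‖) := by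
  have hsum := summable_natCast_add_one_rpow (p := 3 / 2) (by norm_num)
  set K := ∑' n : ℕ, (n + 1 : ℝ) ^ (-(3 / 2) : ℝ) with hK
  have hK0 : 0 ≤ K := tsum_nonneg fun n => by positivity
  refine ⟨4 + K, by positivity, fun s hs ht => ?_⟩
  have hs1 : s ≠ 1 := by rintro rfl; norm_num at ht
  have hn : 1 / 4 ≤ ‖s - 1‖ := ht.trans (by simpa using abs_im_le_norm (s - 1))
  have h1 : ‖∑' n : ℕ, zetaTerm n s‖ ≤ ‖s - 1‖ * ‖s‖ * K := by
    refine tsum_of_norm_bounded (hsum.hasSum.mul_left _) fun n =>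
      (norm_zetaTerm_le (by linarith) n).trans ?_
    refine mul_le_mul_of_nonneg_left ?_ (by positivity)
    exact Real.rpow_le_rpow_of_exponent_le (by linarith [Nat.cast_nonneg (α := ℝ) n]) (by linarith)
  have h2 : ‖s - 1‖ * ‖riemannZeta s‖ ≤ 1 + ‖s - 1‖ * ‖s‖ * K := by
    rw [← norm_mul, sub_one_mul_riemannZeta (by linarith) hs1]
    exact (norm_add_le _ _).trans (by rw [norm_one]; linarith)
  have h3 : ‖s - 1‖ * ‖riemannZeta s‖ ≤ ‖s - 1‖ * (4 + ‖s‖ * K) := by nlinarith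
  have h4 := le_of_mul_le_mul_left h3 (by linarith)
  nlinarith [norm_nonneg s]

/-- Compare the series with that of `ζ(2)`: every base is at least `2`, so `m^(2 - re s) ≤ 2^(2 - re
s)`. This factor gives the decay to the right; at `re s ≥ 2` the bound is already below `1`. -/
theorem norm_riemannZeta_sub_one_le {s : ℂ} (hs : 2 ≤ s.re) :
    ‖riemannZeta s - 1‖ ≤ 2 ^ (2 - s.re) * (Real.pi ^ 2 / 6 - 1) := by
  have h2 := (summable_nat_add_iff 1).2
    (summable_one_div_nat_cpow.2 (by linarith : 1 < s.re))
  have h3 : HasSum (fun n : ℕ => 1 / ((n : ℂ) + 1) ^ s) (riemannZeta s) := by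
    rw [zeta_eq_tsum_one_div_nat_add_one_cpow (by linarith)]
    have := h2.hasSum
    push_cast at this
    exact this
  have h4 := (hasSum_nat_add_iff' 1).2 h3
  have h5 : HasSum (fun n : ℕ => 1 / ((n + 2 : ℕ) : ℝ) ^ 2) (Real.pi ^ 2 / 6 - 1) := by
    have := (hasSum_nat_add_iff' 2).2 hasSum_zeta_two
    simpa [Finset.sum_range_succ] using this
  simp only [Finset.range_one, Finset.sum_singleton, Nat.cast_zero, zero_add, one_cpow, div_one]
    at h4
  rw [← h4.tsum_eq]
  refine tsum_of_norm_bounded (h5.mul_left _) fun n => ?_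
  have hpos : (0 : ℝ) < (n + 2 : ℕ) := by positivity
  have e1 : ((n + 1 : ℕ) : ℂ) + 1 = (((n + 2 : ℕ) : ℝ) : ℂ) := by push_cast; ring
  rw [e1, norm_div, norm_one, norm_cpow_eq_rpow_re_of_pos hpos, one_div, ← Real.rpow_neg hpos.le,
    show -s.re = (2 - s.re) + (-2) by ring, Real.rpow_add hpos]
  have e2 : ((n + 2 : ℕ) : ℝ) ^ (-2 : ℝ) = 1 / ((n + 2 : ℕ) : ℝ) ^ 2 := by
    rw [Real.rpow_neg hpos.le, one_div]
    norm_cast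
  rw [e2]
  refine mul_le_mul_of_nonneg_right ?_ (by positivity)
  exact Real.rpow_le_rpow_of_nonpos (by norm_num) (by push_cast; linarith [Nat.cast_nonneg (α := ℝ) n])
    (by linarith)

/-! ### The functional equation in exponential form -/

/-- The main part of a logarithm of `ζ(1 - s)` in the lower right quadrant. -/
noncomputable def zetaLogMain (s : ℂ) : ℂ :=
  -s * Real.log (2 * Real.pi) + Real.pi / 2 * I * s + (s - 1 / 2) * log s - s

/-- The cosine is written through its dominant exponential for `im s < 0`, so that the remaining
factor `1 + exp(-πis)` is close to `1`. -/
lemma riemannZeta_one_sub_eq {s : ℂ} (hs : 0 < s.re) (hs1 : s ≠ 1) :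
    riemannZeta (1 - s) = exp (-s * Real.log (2 * Real.pi)) * exp (Real.pi / 2 * I * s) *
      (1 + exp (-(Real.pi * I * s))) * Gamma s * riemannZeta s := by
  have hn : ∀ n : ℕ, s ≠ -n := by
    rintro n rfl
    simp at hs
    linarith [Nat.cast_nonneg (α := ℝ) n]
  have hpi : (2 * Real.pi : ℂ) ≠ 0 := by
    have := Real.pi_ne_zero
    simp [this]
  have hlog : log (2 * Real.pi : ℂ) = Real.log (2 * Real.pi) := by
    rw [ofReal_log (by positivity)]; simp
  have hcos : 2 * cos (Real.pi * s / 2) =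
      exp (Real.pi / 2 * I * s) * (1 + exp (-(Real.pi * I * s))) := by
    rw [two_cos, mul_add, mul_one, ← exp_add]
    congr 2 <;> ring
  rw [riemannZeta_one_sub hn hs1, cpow_def_of_ne_zero hpi, hlog]
  linear_combination (exp (Real.log (2 * Real.pi) * -s) * Gamma s * riemannZeta s) * hcos +
    (exp (Real.pi / 2 * I * s) * (1 + exp (-(Real.pi * I * s))) * Gamma s * riemannZeta s) *
      congrArg exp (mul_comm (Real.log (2 * Real.pi) : ℂ) (-s))

lemma norm_exp_neg_pi_I_mul_le {s : ℂ} (hs : s.im ≤ -(1 / 2)) :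
    ‖exp (-(Real.pi * I * s))‖ ≤ 1 / 2 := by
  rw [norm_exp]
  have h1 : (-(Real.pi * I * s)).re = Real.pi * s.im := by simp
  rw [h1, show (1 / 2 : ℝ) = Real.exp (-Real.log 2) by
    rw [Real.exp_neg, Real.exp_log (by norm_num)]; norm_num]
  apply Real.exp_le_exp.2
  have := Real.log_two_lt_d9
  nlinarith [Real.pi_gt_three]

/-- Besides the Stirling remainder, `E` collects the principal logarithms of `1 + exp(-πis)` and
`ζ(s)`. Both lie in discs about `1` of radius less than `1` (`1/2` and `π²/6 - 1 < 0.66`), so these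
logarithms are holomorphic and bounded. -/
theorem exists_riemannZeta_one_sub_eq_exp : ∃ (E : ℂ → ℂ) (C : ℝ),
    DifferentiableOn ℂ E {s | 2 < s.re ∧ s.im < -(1 / 2)} ∧
    (∀ s : ℂ, 2 < s.re → s.im < -(1 / 2) → ‖E s‖ ≤ C) ∧
    ∀ s : ℂ, 2 < s.re → s.im < -(1 / 2) →
      riemannZeta (1 - s) = exp (zetaLogMain s + E s) := by
  obtain ⟨E, C, hE, hEC, hΓ⟩ := exists_Gamma_eq_exp
  set K := Real.pi ^ 2 / 6 - 1 with hK
  have hK1 : K < 0.66 := by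
    have h1 := Real.pi_lt_d2
    have h2 := Real.pi_gt_three
    rw [hK]; nlinarith
  have hK0 : 0 ≤ K := by
    have h2 := Real.pi_gt_three
    rw [hK]; nlinarith
  have hζ : ∀ s : ℂ, 2 < s.re → ‖riemannZeta s - 1‖ ≤ K := fun s hs => by
    refine (norm_riemannZeta_sub_one_le hs.le).trans (mul_le_of_le_one_left hK0 ?_)
    exact Real.rpow_le_one_of_one_le_of_nonpos (by norm_num) (by linarith)
  have hslit1 : ∀ s : ℂ, s.im < -(1 / 2) → 1 + exp (-(Real.pi * I * s)) ∈ slitPlane :=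
    fun s hs => mem_slitPlane_of_norm_lt_one
      ((norm_exp_neg_pi_I_mul_le hs.le).trans_lt (by norm_num))
  have hslit2 : ∀ s : ℂ, 2 < s.re → riemannZeta s ∈ slitPlane := fun s hs => by
    have := mem_slitPlane_of_norm_lt_one (z := riemannZeta s - 1)
      ((hζ s hs).trans_lt (hK1.trans (by norm_num)))
    rwa [add_sub_cancel] at this
  refine ⟨fun s => E s + log (1 + exp (-(Real.pi * I * s))) + log (riemannZeta s),
    C + 1 + 2, ?_, fun s h1 h2 => ?_, fun s h1 h2 => ?_⟩
  · refine ((hE.mono fun s hs => hs.1).add ?_).add ?_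
    · exact DifferentiableOn.clog (by fun_prop) fun s hs => hslit1 s hs.2
    · refine DifferentiableOn.clog (fun s hs => ?_) fun s hs => hslit2 s hs.1
      refine (differentiableAt_riemannZeta ?_).differentiableWithinAt
      rintro rfl
      have := hs.1
      norm_num at this
  · have e1 : ‖log (1 + exp (-(Real.pi * I * s)))‖ ≤ 1 := by
      have h3 := norm_exp_neg_pi_I_mul_le h2.le
      refine (norm_log_one_add_half_le_self h3).trans (by linarith)
    have e2 : ‖log (riemannZeta s)‖ ≤ 2 := by
      have h4 := hζ s h1
      have h5 := norm_log_one_add_le (z := riemannZeta s - 1) (by linarith)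
      rw [add_sub_cancel] at h5
      have h6 : (1 - ‖riemannZeta s - 1‖)⁻¹ ≤ 3 := by
        rw [inv_le_comm₀ (by linarith) (by norm_num)]; linarith
      have h7 : ‖riemannZeta s - 1‖ ^ 2 ≤ 0.66 ^ 2 :=
        pow_le_pow_left₀ (norm_nonneg _) (by linarith) 2
      have h8 : ‖riemannZeta s - 1‖ ^ 2 * (1 - ‖riemannZeta s - 1‖)⁻¹ ≤ 0.66 ^ 2 * 3 :=
        mul_le_mul h7 h6 (inv_nonneg.2 (by linarith)) (by norm_num)
      norm_num at h8
      linarith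
    exact (norm_add₃_le).trans (add_le_add (add_le_add (hEC s h1) e1) e2)
  · have hs1 : s ≠ 1 := by rintro rfl; norm_num at h1
    rw [riemannZeta_one_sub_eq (by linarith) hs1, hΓ s h1, ← exp_log (slitPlane_ne_zero (hslit1 s h2)),
      ← exp_log (slitPlane_ne_zero (hslit2 s h1)), ← exp_add, ← exp_add, ← exp_add, ← exp_add]
    simp only [zetaLogMain]
    congr 1
    ring

/-! ### Size of the exponents and polynomial growth of zeta -/

lemma pi_div_two_add_arg_nonneg {s : ℂ} (hs : 0 < s.re) : 0 ≤ Real.pi / 2 + arg s := by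
  have := (abs_lt.1 (abs_arg_lt_pi_div_two_iff.2 (Or.inl hs))).1
  linarith

/-- Jordan's inequality for the angle `π/2 + arg s`, whose sine is `re s / ‖s‖`. In a vertical strip
the product therefore stays bounded, so the decay of `Γ` is compensated by the exponential up to a
power. -/
lemma neg_im_mul_pi_div_two_add_arg_le {s : ℂ} (hs : 0 < s.re) (ht : s.im ≤ 0) :
    -s.im * (Real.pi / 2 + arg s) ≤ Real.pi / 2 * s.re := by
  have hs0 : s ≠ 0 := by rintro rfl; simp at hs
  have hn : 0 < ‖s‖ := norm_pos_iff.2 hs0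
  have h0 := pi_div_two_add_arg_nonneg hs
  have hle : Real.pi / 2 + arg s ≤ Real.pi / 2 := by
    have := Real.arcsin_nonpos.2 (div_nonpos_of_nonpos_of_nonneg ht hn.le)
    rw [← arg_of_re_nonneg hs.le] at this
    linarith
  have h1 := Real.mul_le_sin h0 hle
  rw [add_comm (Real.pi / 2) (arg s), Real.sin_add_pi_div_two, cos_arg hs0,
    add_comm (arg s)] at h1
  have h2 : Real.pi / 2 + arg s ≤ Real.pi / 2 * (s.re / ‖s‖) := by
    have hp := Real.pi_pos
    calc Real.pi / 2 + arg s = Real.pi / 2 * (2 / Real.pi * (Real.pi / 2 + arg s)) := by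
          field_simp
      _ ≤ _ := by gcongr
  have h3 : -s.im ≤ ‖s‖ := (neg_le_abs _).trans (abs_im_le_norm s)
  calc -s.im * (Real.pi / 2 + arg s) ≤ ‖s‖ * (Real.pi / 2 * (s.re / ‖s‖)) :=
        mul_le_mul h3 h2 h0 hn.le
    _ = Real.pi / 2 * s.re := by field_simp

lemma re_sub_half_mul_log (s : ℂ) : ((s - 1 / 2) * log s).re =
    (s.re - 1 / 2) * Real.log ‖s‖ - s.im * arg s := by
  simp [mul_re, log_re, log_im]

lemma im_sub_half_mul_log (s : ℂ) : ((s - 1 / 2) * log s).im =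
    (s.re - 1 / 2) * arg s + s.im * Real.log ‖s‖ := by
  simp [mul_im, log_re, log_im]

lemma re_zetaLogMain (s : ℂ) : (zetaLogMain s).re =
    (s.re - 1 / 2) * Real.log ‖s‖ - s.im * (Real.pi / 2 + arg s) -
      s.re * (Real.log (2 * Real.pi) + 1) := by
  have h1 : (-s * (Real.log (2 * Real.pi) : ℂ)).re = -s.re * Real.log (2 * Real.pi) := by
    rw [re_mul_ofReal, neg_re]
  have h2 : ((Real.pi : ℂ) / 2 * I * s).re = -(Real.pi / 2 * s.im) := by
    simp [mul_re, mul_im]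
  rw [zetaLogMain, sub_re, add_re, add_re, re_sub_half_mul_log, h1, h2]
  ring

lemma im_zetaLogMain (s : ℂ) : (zetaLogMain s).im =
    -s.im * Real.log (2 * Real.pi) + Real.pi / 2 * s.re + (s.re - 1 / 2) * arg s +
      s.im * Real.log ‖s‖ - s.im := by
  have h1 : (-s * (Real.log (2 * Real.pi) : ℂ)).im = -s.im * Real.log (2 * Real.pi) := by
    rw [im_mul_ofReal, neg_im]
  have h2 : ((Real.pi : ℂ) / 2 * I * s).im = Real.pi / 2 * s.re := by
    simp [mul_re, mul_im]
  rw [zetaLogMain, sub_im, add_im, add_im, im_sub_half_mul_log, h1, h2]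
  ring

/-- Polynomial bound for `Γ(s)` multiplied by the exponential factor which compensates its decay. -/
lemma exists_norm_Gamma_mul_exp_le (B : ℝ) : ∃ (C : ℝ) (A : ℕ), 0 ≤ C ∧ ∀ s : ℂ, 1 / 2 ≤ s.re →
    s.re ≤ B → s.im ≤ 0 → ‖Gamma s‖ * Real.exp (-(Real.pi / 2) * s.im) ≤ C * (3 + ‖s‖) ^ A := by
  obtain ⟨E, C, -, hEC, hΓ⟩ := exists_Gamma_eq_exp
  set A := ⌈B + 2⌉₊ with hA
  refine ⟨4 * Real.exp (C + Real.pi / 2 * (B + 2)), A, by positivity, fun s h1 hB ht => ?_⟩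
  have hs0 : s ≠ 0 := by rintro rfl; norm_num at h1
  have hs1 : s + 1 ≠ 0 := fun h => by
    have := congrArg re h; simp at this; linarith
  -- Two steps of the recurrence move `s` into the half-plane of Stirling's formula; `|s (s + 1)| ≥
  -- 1/4` controls the division.
  have hG : Gamma (s + 2) = (s + 1) * s * Gamma s := by
    rw [show s + 2 = s + 1 + 1 by ring, Gamma_add_one _ hs1, Gamma_add_one _ hs0, mul_assoc]
  have hre : 2 < (s + 2).re := by simp; linarith
  have hn0 : 1 / 2 ≤ ‖s‖ := h1.trans (re_le_norm s)
  have hn1 : 1 / 2 ≤ ‖s + 1‖ := le_trans (by simp; linarith) (re_le_norm (s + 1))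
  have hn2 : 1 ≤ ‖s + 2‖ := le_trans (by simp; linarith) (re_le_norm (s + 2))
  have hΓle : ‖Gamma s‖ ≤ 4 * ‖Gamma (s + 2)‖ := by
    rw [hG, norm_mul, norm_mul]
    have h3 : 1 / 4 ≤ ‖s + 1‖ * ‖s‖ := by nlinarith
    nlinarith [norm_nonneg (Gamma s)]
  have hlog0 : 0 ≤ Real.log ‖s + 2‖ := Real.log_nonneg hn2
  have hexp : ‖Gamma (s + 2)‖ * Real.exp (-(Real.pi / 2) * s.im) ≤
      Real.exp (C + Real.pi / 2 * (B + 2)) * ‖s + 2‖ ^ A := by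
    have e1 : ‖s + 2‖ ^ A = Real.exp (A * Real.log ‖s + 2‖) := by
      rw [Real.exp_nat_mul, Real.exp_log (by linarith)]
    rw [hΓ _ hre, norm_exp, e1, ← Real.exp_add, ← Real.exp_add]
    apply Real.exp_le_exp.2
    rw [add_re, sub_re, re_sub_half_mul_log]
    have e2 := neg_im_mul_pi_div_two_add_arg_le (s := s + 2) (by linarith) (by simpa using ht)
    have e3 : (E (s + 2)).re ≤ C := (re_le_norm _).trans (hEC _ hre)
    have e4 : ((s + 2).re - 1 / 2) * Real.log ‖s + 2‖ ≤ A * Real.log ‖s + 2‖ := by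
      refine mul_le_mul_of_nonneg_right ?_ hlog0
      refine le_trans ?_ (Nat.le_ceil (B + 2))
      simp; linarith
    have e5 : (s + 2).im = s.im := by simp
    have e6 : (s + 2).re = s.re + 2 := by simp
    rw [e5, e6] at e2 ⊢
    rw [e6] at e4
    have e7 : Real.pi / 2 * (s.re + 2) ≤ Real.pi / 2 * (B + 2) := by gcongr
    linarith
  have hn3 : ‖s + 2‖ ≤ 3 + ‖s‖ := (norm_add_le _ _).trans (by norm_num; linarith)
  calc ‖Gamma s‖ * Real.exp (-(Real.pi / 2) * s.im)
      ≤ 4 * (‖Gamma (s + 2)‖ * Real.exp (-(Real.pi / 2) * s.im)) := by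
        rw [← mul_assoc]; gcongr
    _ ≤ 4 * (Real.exp (C + Real.pi / 2 * (B + 2)) * (3 + ‖s‖) ^ A) := by
        gcongr 4 * ?_
        exact hexp.trans (by gcongr)
    _ = _ := by ring

/-- Polynomial growth of `ζ` in half-planes, away from the real axis. -/
theorem exists_norm_riemannZeta_le_pow (B : ℝ) : ∃ (C : ℝ) (A : ℕ), 0 ≤ C ∧ ∀ z : ℂ, -B ≤ z.re →
    1 / 2 ≤ z.im → ‖riemannZeta z‖ ≤ C * (4 + ‖z‖) ^ A := by
  obtain ⟨C₁, hC₁, h₁⟩ := exists_norm_riemannZeta_le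
  obtain ⟨C₂, A, hC₂, h₂⟩ := exists_norm_Gamma_mul_exp_le (1 + B)
  refine ⟨C₁ + 2 * C₂ * C₁, A + 1, by positivity, fun z hz ht => ?_⟩
  have hbase : 1 ≤ 4 + ‖z‖ := by linarith [norm_nonneg z]
  rcases le_total (1 / 2) z.re with hr | hr
  · have e1 := h₁ z hr (by rw [abs_of_nonneg] <;> linarith)
    have e2 : 4 + ‖z‖ ≤ (4 + ‖z‖) ^ (A + 1) := le_self_pow₀ hbase (by simp)
    calc ‖riemannZeta z‖ ≤ C₁ * (4 + ‖z‖) ^ (A + 1) := by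
          refine e1.trans (mul_le_mul_of_nonneg_left ?_ hC₁)
          linarith
      _ ≤ _ := by
          refine mul_le_mul_of_nonneg_right ?_ (by positivity)
          nlinarith [mul_nonneg hC₂ hC₁]
  -- Left of the critical line, reflect: the exponential growth of the cosine is paired with the
  -- decay of `Γ`, and `ζ(s)` is bounded on the right.
  · set s := 1 - z with hs
    have hsre : s.re = 1 - z.re := by simp [hs]
    have hsim : s.im = -z.im := by simp [hs]
    have hs1 : s ≠ 1 := fun h => by rw [h] at hsim; simp at hsim; linarith
    have hns : ‖s‖ ≤ 1 + ‖z‖ := (norm_sub_le _ _).trans (by norm_num)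
    have e1 := h₂ s (by linarith) (by linarith) (by linarith)
    have e2 := h₁ s (by linarith) (by rw [hsim, abs_neg, abs_of_nonneg] <;> linarith)
    have e3 : ‖exp (-s * Real.log (2 * Real.pi))‖ ≤ 1 := by
      rw [norm_exp, re_mul_ofReal, neg_re, ← Real.exp_zero]
      apply Real.exp_le_exp.2
      have : 0 ≤ Real.log (2 * Real.pi) := Real.log_nonneg (by linarith [Real.pi_gt_three])
      nlinarith
    have e4 : ‖exp (Real.pi / 2 * I * s)‖ = Real.exp (-(Real.pi / 2) * s.im) := by
      rw [norm_exp]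
      simp [mul_re, mul_im]
    have e5 : ‖1 + exp (-(Real.pi * I * s))‖ ≤ 2 := by
      refine (norm_add_le _ _).trans ?_
      have := norm_exp_neg_pi_I_mul_le (s := s) (by linarith)
      rw [norm_one]; linarith
    have e6 : riemannZeta z = riemannZeta (1 - s) := by rw [hs, sub_sub_cancel]
    rw [e6, riemannZeta_one_sub_eq (by linarith) hs1, norm_mul, norm_mul, norm_mul, norm_mul, e4]
    calc ‖exp (-s * Real.log (2 * Real.pi))‖ * Real.exp (-(Real.pi / 2) * s.im) *
          ‖1 + exp (-(Real.pi * I * s))‖ * ‖Gamma s‖ * ‖riemannZeta s‖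
        = ‖exp (-s * Real.log (2 * Real.pi))‖ * ‖1 + exp (-(Real.pi * I * s))‖ *
          (‖Gamma s‖ * Real.exp (-(Real.pi / 2) * s.im)) * ‖riemannZeta s‖ := by ring
      _ ≤ 1 * 2 * (C₂ * (3 + ‖s‖) ^ A) * (C₁ * (1 + ‖s‖)) := by gcongr
      _ ≤ 1 * 2 * (C₂ * (4 + ‖z‖) ^ A) * (C₁ * (4 + ‖z‖)) := by
          gcongr 1 * 2 * (C₂ * ?_ ^ A) * (C₁ * ?_) <;> linarith
      _ = 2 * C₂ * C₁ * (4 + ‖z‖) ^ (A + 1) := by ring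
      _ ≤ _ := by
          refine mul_le_mul_of_nonneg_right ?_ (by positivity)
          linarith

/-! ### Iterated derivatives of an exponential in a quadrant -/

/-- A family of shrinking truncated lower right quadrants. -/
def lowerQuadrant (R δ : ℝ) : Set ℂ :=
  {s | 2 + δ < s.re ∧ s.im < -(1 / 2) - δ ∧ R + δ < ‖s‖}

lemma isOpen_lowerQuadrant (R δ : ℝ) : IsOpen (lowerQuadrant R δ) :=
  (isOpen_lt continuous_const continuous_re).inter
    ((isOpen_lt continuous_im continuous_const).inter (isOpen_lt continuous_const continuous_norm))

lemma lowerQuadrant_anti {R R' δ δ' : ℝ} (hR : R ≤ R') (h : δ ≤ δ') :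
    lowerQuadrant R' δ' ⊆ lowerQuadrant R δ :=
  fun s hs => ⟨by linarith [hs.1], by linarith [hs.2.1], by linarith [hs.2.2]⟩

/-- Raising `δ` leaves discs of fixed radius inside the larger quadrant, so Cauchy's estimate holds
uniformly at the cost of a slightly smaller domain. -/
lemma closedBall_subset_lowerQuadrant {R δ δ' : ℝ} (h : δ < δ') {s : ℂ}
    (hs : s ∈ lowerQuadrant R δ') :
    Metric.closedBall s ((δ' - δ) / 2) ⊆ lowerQuadrant R δ := by
  intro w hw
  rw [mem_closedBall_iff_norm] at hw
  obtain ⟨h1, h2, h3⟩ := hs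
  have e1 := abs_le.1 ((abs_re_le_norm (w - s)).trans hw)
  have e2 := abs_le.1 ((abs_im_le_norm (w - s)).trans hw)
  have e3 := norm_sub_norm_le s w
  rw [norm_sub_rev] at e3
  simp only [sub_re, sub_im] at e1 e2
  exact ⟨by linarith, by linarith, by linarith⟩

lemma norm_deriv_le_of_lowerQuadrant {q : ℂ → ℂ} {R δ δ' C : ℝ} (h : δ < δ')
    (hq : DifferentiableOn ℂ q (lowerQuadrant R δ)) (hC : ∀ s ∈ lowerQuadrant R δ, ‖q s‖ ≤ C) :
    ∀ s ∈ lowerQuadrant R δ', ‖deriv q s‖ ≤ C / ((δ' - δ) / 2) := by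
  intro s hs
  have hb := closedBall_subset_lowerQuadrant h hs
  have hr : 0 < (δ' - δ) / 2 := by linarith
  refine norm_deriv_le_of_forall_mem_sphere_norm_le hr ?_ fun w hw =>
    hC w (hb (Metric.sphere_subset_closedBall hw))
  refine (hq.mono ?_).diffContOnCl
  rwa [closure_ball s hr.ne']

/-- The filter of points tending to infinity within a truncated quadrant. -/
noncomputable abbrev lowerQuadrantFilter (R δ : ℝ) : Filter ℂ := Bornology.cobounded ℂ ⊓ 𝓟 (lowerQuadrant R δ)

lemma eventually_lowerQuadrantFilter {R δ : ℝ} {p : ℂ → Prop} :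
    (∀ᶠ s in lowerQuadrantFilter R δ, p s) ↔
      ∃ M : ℝ, ∀ s ∈ lowerQuadrant R δ, M ≤ ‖s‖ → p s := by
  rw [eventually_inf_principal, ← comap_norm_atTop, eventually_comap, eventually_atTop]
  constructor
  · rintro ⟨M, hM⟩
    exact ⟨M, fun s hs h => hM _ h s rfl hs⟩
  · rintro ⟨M, hM⟩
    exact ⟨M, fun b hb s hs h => hM s h (by rw [hs]; exact hb)⟩

lemma tendsto_deriv_lowerQuadrantFilter {q : ℂ → ℂ} {R δ δ' : ℝ} {c : ℂ} (h : δ < δ')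
    (hq : DifferentiableOn ℂ q (lowerQuadrant R δ))
    (hlim : Tendsto q (lowerQuadrantFilter R δ) (𝓝 c)) :
    Tendsto (deriv q) (lowerQuadrantFilter R δ') (𝓝 0) := by
  have hr : 0 < (δ' - δ) / 2 := by linarith
  rw [Metric.tendsto_nhds] at hlim ⊢
  intro ε hε
  obtain ⟨M, hM⟩ := eventually_lowerQuadrantFilter.1
    (hlim (ε / 2 * ((δ' - δ) / 2)) (by positivity))
  refine eventually_lowerQuadrantFilter.2 ⟨M + (δ' - δ) / 2, fun s hs hsM => ?_⟩
  have hb := closedBall_subset_lowerQuadrant h hs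
  have h1 : ‖deriv (fun w => q w - c) s‖ ≤ (ε / 2 * ((δ' - δ) / 2)) / ((δ' - δ) / 2) := by
    refine norm_deriv_le_of_forall_mem_sphere_norm_le hr ?_ fun w hw => ?_
    · refine ((hq.sub_const c).mono ?_).diffContOnCl
      rwa [closure_ball s hr.ne']
    · rw [← dist_eq_norm]
      refine (hM w (hb (Metric.sphere_subset_closedBall hw)) ?_).le
      rw [mem_sphere_iff_norm] at hw
      have e3 := norm_sub_norm_le s w
      rw [norm_sub_rev] at e3
      linarith
  rw [deriv_sub_const, mul_div_cancel_right₀ _ hr.ne'] at h1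
  rw [dist_zero_right]
  linarith

/-- If `f = exp H` with `H'` large and `H''` bounded, then `f⁽ᵏ⁾ ∼ f (H')ᵏ`. -/
theorem iteratedDeriv_eq_exp_mul {f H W : ℂ → ℂ} {R δ₀ C : ℝ}
    (hf : ∀ s ∈ lowerQuadrant R δ₀, f s = exp (H s))
    (hH : ∀ s ∈ lowerQuadrant R δ₀, HasDerivAt H (W s) s)
    (hW : DifferentiableOn ℂ W (lowerQuadrant R δ₀)) (hW0 : ∀ s ∈ lowerQuadrant R δ₀, W s ≠ 0)
    (hWinf : Tendsto (fun s => (W s)⁻¹) (lowerQuadrantFilter R δ₀) (𝓝 0))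
    (hWd : ∀ s ∈ lowerQuadrant R δ₀, ‖deriv W s‖ ≤ C) (k : ℕ) :
    ∀ δ, δ₀ < δ → ∃ q : ℂ → ℂ, DifferentiableOn ℂ q (lowerQuadrant R δ) ∧
      Tendsto q (lowerQuadrantFilter R δ) (𝓝 1) ∧
      ∀ s ∈ lowerQuadrant R δ, iteratedDeriv k f s = exp (H s) * W s ^ k * q s := by
  induction k with
  | zero =>
    intro δ hδ
    refine ⟨fun _ => 1, differentiableOn_const _, tendsto_const_nhds, fun s hs => ?_⟩
    simpa using hf s (lowerQuadrant_anti le_rfl hδ.le hs)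
  | succ k ih =>
    intro δ hδ
    -- The midpoint leaves room for one more Cauchy estimate.
    obtain ⟨q, hq, hq1, hfq⟩ := ih ((δ₀ + δ) / 2) (by linarith)
    have hlt : (δ₀ + δ) / 2 < δ := by linarith
    have hsub : lowerQuadrant R δ ⊆ lowerQuadrant R ((δ₀ + δ) / 2) :=
      lowerQuadrant_anti le_rfl hlt.le
    have hsub0 : lowerQuadrant R δ ⊆ lowerQuadrant R δ₀ := lowerQuadrant_anti le_rfl hδ.le
    have hfil : lowerQuadrantFilter R δ ≤ lowerQuadrantFilter R ((δ₀ + δ) / 2) :=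
      inf_le_inf_left _ (principal_mono.2 hsub)
    have hfil0 : lowerQuadrantFilter R δ ≤ lowerQuadrantFilter R δ₀ :=
      inf_le_inf_left _ (principal_mono.2 hsub0)
    have hqd := (hq.deriv (isOpen_lowerQuadrant _ _)).mono hsub
    have hWd' := (hW.deriv (isOpen_lowerQuadrant _ _)).mono hsub0
    -- Differentiating `exp(H) Wᵏ q` and dividing by `exp(H) Wᵏ⁺¹` gives `q + q'/W + k q W'/W²`; the
    -- last two terms tend to `0`.
    refine ⟨fun s => q s + deriv q s * (W s)⁻¹ + k * q s * (W s)⁻¹ * ((W s)⁻¹ * deriv W s),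
      ?_, ?_, fun s hs => ?_⟩
    · have hi : DifferentiableOn ℂ (fun s => (W s)⁻¹) (lowerQuadrant R δ) :=
        (hW.mono hsub0).fun_inv fun s hs => hW0 s (hsub0 hs)
      exact ((hq.mono hsub).add (hqd.mul hi)).add
        ((((hq.mono hsub).const_mul (k : ℂ)).mul hi).mul (hi.mul hWd'))
    · have hi := hWinf.mono_left hfil0
      have h1 := hq1.mono_left hfil
      have h2 := tendsto_deriv_lowerQuadrantFilter hlt hq hq1
      have h3 : Tendsto (fun s => (W s)⁻¹ * deriv W s) (lowerQuadrantFilter R δ) (𝓝 0) := by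
        refine hi.zero_mul_isBoundedUnder_le ?_
        refine isBoundedUnder_of_eventually_le (a := C) ?_
        exact eventually_lowerQuadrantFilter.2 ⟨0, fun s hs _ => hWd s (hsub0 hs)⟩
      have h4 := (h1.add (h2.mul hi)).add (((h1.const_mul (k : ℂ)).mul hi).mul h3)
      simpa using h4
    · rw [iteratedDeriv_succ]
      have hev : iteratedDeriv k f =ᶠ[𝓝 s] fun s => exp (H s) * W s ^ k * q s := by
        filter_upwards [(isOpen_lowerQuadrant R _).mem_nhds (hsub hs)] with w hw using hfq w hw
      have hWs := (hW.differentiableAt ((isOpen_lowerQuadrant R _).mem_nhds (hsub0 hs))).hasDerivAt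
      have hqs := (hq.differentiableAt ((isOpen_lowerQuadrant R _).mem_nhds (hsub hs))).hasDerivAt
      have hne := hW0 s (hsub0 hs)
      have hd := ((hH s (hsub0 hs)).cexp.mul (hWs.pow k)).mul hqs
      rw [hev.deriv_eq]
      refine hd.deriv.trans ?_
      simp only [Pi.mul_apply, Pi.pow_apply]
      rcases k with _ | k
      · simp
        field_simp
      · simp only [Nat.add_sub_cancel]
        field_simp
        ring

/-! ### The logarithm of `ζ⁽ᵏ⁾ - a` far to the left -/

lemma hasDerivAt_zetaLogMain {s : ℂ} (hs : s ∈ slitPlane) :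
    HasDerivAt zetaLogMain
      (-Real.log (2 * Real.pi) + Real.pi / 2 * I + log s - 1 / 2 * s⁻¹) s := by
  have h0 : s ≠ 0 := slitPlane_ne_zero hs
  have h1 : HasDerivAt (fun s : ℂ => -s * Real.log (2 * Real.pi))
      (-1 * Real.log (2 * Real.pi)) s := (hasDerivAt_id s).neg.mul_const _
  have h2 : HasDerivAt (fun s : ℂ => Real.pi / 2 * I * s) (Real.pi / 2 * I * 1) s :=
    (hasDerivAt_id s).const_mul _
  have h3 : HasDerivAt (fun s : ℂ => (s - 1 / 2) * log s)
      (1 * log s + (s - 1 / 2) * s⁻¹) s :=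
    ((hasDerivAt_id s).sub_const _).mul (hasDerivAt_log hs)
  convert! ((h1.add h2).add h3).sub (hasDerivAt_id s) using 1
  field_simp
  ring

lemma tendsto_log_norm_lowerQuadrantFilter (R δ : ℝ) :
    Tendsto (fun s : ℂ => Real.log ‖s‖) (lowerQuadrantFilter R δ) atTop :=
  (Real.tendsto_log_atTop.comp tendsto_norm_cobounded_atTop).mono_left inf_le_left

/-- The angular term of `re_zetaLogMain` is nonnegative, and for `re s ≥ 2` one has `re s - 1/2 ≥
(3/4) re s`. Once `log ‖s‖ ≥ 4` this beats the linear loss `3 re s` and leaves `(3/2) log ‖s‖ - 6`,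
uniformly in `re s`. -/
lemma tendsto_exp_neg_zetaLogMain_add {E : ℂ → ℂ} {R δ C : ℝ} (hδ : 0 ≤ δ)
    (hE : ∀ s ∈ lowerQuadrant R δ, ‖E s‖ ≤ C) :
    Tendsto (fun s => exp (-(zetaLogMain s + E s))) (lowerQuadrantFilter R δ) (𝓝 0) := by
  rw [tendsto_zero_iff_norm_tendsto_zero]
  simp only [norm_exp, neg_re]
  refine Real.tendsto_exp_neg_atTop_nhds_zero.comp ?_
  have hlog := tendsto_log_norm_lowerQuadrantFilter R δ
  have h1 : Tendsto (fun s : ℂ => 3 / 2 * Real.log ‖s‖ + (-6 - C)) (lowerQuadrantFilter R δ)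
      atTop := tendsto_atTop_add_const_right _ _ (hlog.const_mul_atTop (by norm_num))
  refine tendsto_atTop_mono' _ ?_ h1
  filter_upwards [hlog.eventually_ge_atTop 4, mem_inf_of_right (mem_principal_self _)] with s hs hsQ
  obtain ⟨h2, h3, -⟩ := id hsQ
  have h2π : Real.log (2 * Real.pi) ≤ 2 := by
    rw [Real.log_le_iff_le_exp (by positivity), show (2 : ℝ) = 1 + 1 by norm_num, Real.exp_add]
    have e1 := Real.exp_one_gt_d9
    have e2 := Real.pi_lt_d2
    norm_num
    nlinarith
  have e1 := pi_div_two_add_arg_nonneg (s := s) (by linarith)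
  have e2 : 0 ≤ -s.im * (Real.pi / 2 + arg s) := mul_nonneg (by linarith) e1
  have e3 := (abs_le.1 ((abs_re_le_norm (E s)).trans (hE s hsQ))).1
  rw [add_re, re_zetaLogMain]
  have e4 : s.re * (Real.log (2 * Real.pi) + 1) ≤ s.re * 3 :=
    mul_le_mul_of_nonneg_left (by linarith) (by linarith)
  have e5 : 3 / 4 * s.re * Real.log ‖s‖ ≤ (s.re - 1 / 2) * Real.log ‖s‖ :=
    mul_le_mul_of_nonneg_right (by linarith) (by linarith)
  have e6 : 0 ≤ (s.re - 2) * (3 / 4 * Real.log ‖s‖ - 3) :=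
    mul_nonneg (by linarith) (by linarith)
  nlinarith

/-- Far to the left, `ζ⁽ᵏ⁾ - a` has a holomorphic logarithm, whose imaginary part is given up to
a bounded error by `zetaLogMain`. -/
theorem exists_log_iteratedDeriv_riemannZeta_sub_left (k : ℕ) (a : ℂ) :
    ∃ (ℓ : ℂ → ℂ) (R C : ℝ),
      DifferentiableOn ℂ ℓ {z | z.re < -(3 / 2) ∧ 3 / 4 < z.im ∧ R < ‖z‖} ∧
      (∀ z : ℂ, z.re < -(3 / 2) → 3 / 4 < z.im → R < ‖z‖ →
        iteratedDeriv k riemannZeta z - a = exp (ℓ z)) ∧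
      ∀ z : ℂ, z.re < -(3 / 2) → 3 / 4 < z.im → R < ‖z‖ →
        |(ℓ z).im - (zetaLogMain (1 - z)).im| ≤ C := by
  obtain ⟨E, C, hE, hEC, hζ⟩ := exists_riemannZeta_one_sub_eq_exp
  have hC0 : 0 ≤ C := (norm_nonneg _).trans (hEC (3 - I) (by norm_num) (by norm_num))
  have hEQ : ∀ {R δ : ℝ}, 0 ≤ δ → lowerQuadrant R δ ⊆ {s | 2 < s.re ∧ s.im < -(1 / 2)} :=
    fun hδ s hs => ⟨by linarith [hs.1], by linarith [hs.2.1]⟩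
  have hEQC : ∀ {R δ : ℝ}, 0 ≤ δ → ∀ s ∈ lowerQuadrant R δ, ‖E s‖ ≤ C := fun hδ s hs =>
    hEC s (hEQ hδ hs).1 (hEQ hδ hs).2
  have hslit : ∀ {R δ : ℝ}, 0 ≤ δ → ∀ s ∈ lowerQuadrant R δ, s ∈ slitPlane := fun hδ s hs =>
    Or.inl (by linarith [(hEQ hδ hs).1])
  have hinv : ∀ {R δ : ℝ}, 0 ≤ δ → ∀ s ∈ lowerQuadrant R δ, ‖s⁻¹‖ ≤ 1 := fun hδ s hs =>
    (norm_inv_lt_half (hEQ hδ hs).1).le.trans (by norm_num)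
  set c₁ : ℂ := -Real.log (2 * Real.pi) + Real.pi / 2 * I with hc₁
  set V : ℂ → ℂ := fun s => c₁ - 1 / 2 * s⁻¹ + deriv E s with hV
  -- The last summand is Cauchy's bound for `E'`. The margins grow as `0` for `E`, `1/16` for `E'`,
  -- `1/8` for `W'` and `1/4` for the `k` derivatives; the last one yields the conditions `re z <
  -- -3/2` and `im z > 3/4`.
  set K : ℝ := ‖c₁‖ + 1 / 2 + C / ((1 / 16 - 0) / 2) with hK
  have hVd : DifferentiableOn ℂ V (lowerQuadrant 0 (1 / 16)) := by
    refine DifferentiableOn.add (DifferentiableOn.const_sub (DifferentiableOn.const_mul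
      (differentiableOn_inv.mono fun s hs => slitPlane_ne_zero (hslit (by norm_num) s hs)) _) _) ?_
    exact ((hE.mono (hEQ le_rfl)).deriv (isOpen_lowerQuadrant 0 0)).mono
      (lowerQuadrant_anti le_rfl (by norm_num))
  have hVK : ∀ s ∈ lowerQuadrant 0 (1 / 16), ‖V s‖ ≤ K := fun s hs => by
    refine (norm_add_le _ _).trans (add_le_add ((norm_sub_le _ _).trans ?_) ?_)
    · rw [norm_mul]
      have := hinv (by norm_num) s hs
      have h2 : ‖(1 / 2 : ℂ)‖ = 1 / 2 := by norm_num
      rw [h2]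
      linarith
    · exact norm_deriv_le_of_lowerQuadrant (by norm_num) (hE.mono (hEQ le_rfl)) (hEQC le_rfl) s hs
  have hK0 : 0 ≤ K := by positivity
  set W : ℂ → ℂ := fun s => log s + V s with hW
  -- Beyond this radius `log ‖s‖ > K + 1`, so `W = H'` has positive real part and a principal
  -- logarithm.
  set R₀ := Real.exp (K + 1) with hR₀
  have hR₀0 : 0 ≤ R₀ := (Real.exp_pos _).le
  have hsub : lowerQuadrant R₀ (1 / 8) ⊆ lowerQuadrant 0 (1 / 16) :=
    lowerQuadrant_anti hR₀0 (by norm_num)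
  have hWre' : ∀ s ∈ lowerQuadrant R₀ (1 / 8), Real.log ‖s‖ - K ≤ (W s).re := fun s hs => by
    have h1 := (abs_le.1 ((abs_re_le_norm (V s)).trans (hVK s (hsub hs)))).1
    rw [hW, add_re, log_re]
    linarith
  have hWre : ∀ s ∈ lowerQuadrant R₀ (1 / 8), 0 < (W s).re := fun s hs => by
    have h1 := hWre' s hs
    have h2 : K + 1 < Real.log ‖s‖ := by
      rw [Real.lt_log_iff_exp_lt ((Real.exp_pos _).trans_le (by linarith [hs.2.2] : R₀ ≤ ‖s‖))]
      linarith [hs.2.2]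
    linarith
  have hWd : DifferentiableOn ℂ W (lowerQuadrant R₀ (1 / 8)) := by
    refine DifferentiableOn.add (fun s hs => ?_) (hVd.mono hsub)
    exact (hasDerivAt_log (hslit (by norm_num) s hs)).differentiableAt.differentiableWithinAt
  have hHd : ∀ s ∈ lowerQuadrant R₀ (1 / 8),
      HasDerivAt (fun s => zetaLogMain s + E s) (W s) s := fun s hs => by
    have h1 := hE.differentiableAt (((isOpen_lowerQuadrant R₀ (1 / 8)).mem_nhds hs |>
      fun h => mem_of_superset h (hEQ (by norm_num))))
    convert! (hasDerivAt_zetaLogMain (hslit (by norm_num) s hs)).add h1.hasDerivAt using 1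
    simp only [hW, hV, hc₁]
    ring
  have hWinf : Tendsto (fun s => (W s)⁻¹) (lowerQuadrantFilter R₀ (1 / 8)) (𝓝 0) := by
    rw [tendsto_zero_iff_norm_tendsto_zero]
    simp only [norm_inv]
    refine tendsto_inv_atTop_zero.comp ?_
    refine tendsto_atTop_mono' _ ?_ (tendsto_atTop_add_const_right _ (-K)
      (tendsto_log_norm_lowerQuadrantFilter R₀ (1 / 8)))
    filter_upwards [mem_inf_of_right (mem_principal_self _)] with s hs
    exact (hWre' s hs).trans (re_le_norm _)
  have hWdd : ∀ s ∈ lowerQuadrant R₀ (1 / 8), ‖deriv W s‖ ≤ 1 + K / ((1 / 8 - 1 / 16) / 2) := by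
    intro s hs
    have h1 := hVd.differentiableAt ((isOpen_lowerQuadrant 0 (1 / 16)).mem_nhds (hsub hs))
    have h2 := (hasDerivAt_log (hslit (by norm_num) s hs)).add h1.hasDerivAt
    rw [show W = log + V from rfl, h2.deriv]
    refine (norm_add_le _ _).trans (add_le_add (hinv (by norm_num) s hs) ?_)
    exact norm_deriv_le_of_lowerQuadrant (by norm_num) hVd hVK s
      (lowerQuadrant_anti hR₀0 le_rfl hs)
  obtain ⟨q, hq, hq1, hfq⟩ := iteratedDeriv_eq_exp_mul (f := fun s => riemannZeta (1 - s))
    (fun s hs => hζ s (hEQ (by norm_num) hs).1 (hEQ (by norm_num) hs).2) hHd hWd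
    (fun s hs h => by have := hWre s hs; rw [h] at this; simp at this) hWinf hWdd k (1 / 4)
    (by norm_num)
  have hsub' : lowerQuadrant R₀ (1 / 4) ⊆ lowerQuadrant R₀ (1 / 8) :=
    lowerQuadrant_anti le_rfl (by norm_num)
  have hfil : lowerQuadrantFilter R₀ (1 / 4) ≤ lowerQuadrantFilter R₀ (1 / 8) :=
    inf_le_inf_left _ (principal_mono.2 hsub')
  -- This is `a` divided by `ζ⁽ᵏ⁾(1 - s)`, so that `ζ⁽ᵏ⁾ - a` acquires the factor `1 - u` with `u →
  -- 0`.
  set u : ℂ → ℂ := fun s =>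
    a * (-1) ^ k * exp (-(zetaLogMain s + E s)) * ((W s)⁻¹) ^ k * (q s)⁻¹ with hu
  have hu0 : Tendsto u (lowerQuadrantFilter R₀ (1 / 4)) (𝓝 0) := by
    have h1 := tendsto_exp_neg_zetaLogMain_add (R := R₀) (δ := 1 / 4) (by norm_num)
      (hEQC (by norm_num))
    have h2 := (((h1.const_mul (a * (-1) ^ k)).mul ((hWinf.mono_left hfil).pow k))).mul
      (hq1.inv₀ one_ne_zero)
    rwa [mul_zero, zero_mul, zero_mul] at h2
  obtain ⟨M, hM⟩ := eventually_lowerQuadrantFilter.1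
    ((Metric.tendsto_nhds.1 hq1 1 one_pos).and (Metric.tendsto_nhds.1 hu0 1 one_pos))
  set R := max (R₀ + 1 / 4) M + 1 with hR
  have hmem : ∀ z : ℂ, z.re < -(3 / 2) → 3 / 4 < z.im → R < ‖z‖ →
      1 - z ∈ lowerQuadrant R₀ (1 / 4) ∧ M ≤ ‖1 - z‖ := by
    intro z h1 h2 h3
    have h4 : ‖z‖ - 1 ≤ ‖1 - z‖ := by
      have := norm_sub_norm_le z 1
      rwa [norm_one, norm_sub_rev] at this
    have h5 := le_max_left (R₀ + 1 / 4) M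
    have h6 := le_max_right (R₀ + 1 / 4) M
    refine ⟨⟨?_, ?_, ?_⟩, ?_⟩
    · simp; linarith
    · simp; linarith
    · linarith
    · linarith
  have hqs : ∀ s ∈ lowerQuadrant R₀ (1 / 4), M ≤ ‖s‖ → q s ∈ slitPlane := fun s hs hsM => by
    have h1 := (hM s hs hsM).1
    rw [dist_eq_norm] at h1
    have h2 := mem_slitPlane_of_norm_lt_one h1
    rwa [add_sub_cancel] at h2
  have hus : ∀ s ∈ lowerQuadrant R₀ (1 / 4), M ≤ ‖s‖ → 1 - u s ∈ slitPlane := fun s hs hsM => by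
    have h1 := (hM s hs hsM).2
    rw [dist_zero_right, ← norm_neg] at h1
    simpa [sub_eq_add_neg] using mem_slitPlane_of_norm_lt_one h1
  have hWs : ∀ s ∈ lowerQuadrant R₀ (1 / 4), W s ∈ slitPlane := fun s hs =>
    Or.inl (hWre s (hsub' hs))
  -- The summand `k πi` accounts for the sign `(-1)ᵏ` from differentiating in `1 - z`. The other
  -- logarithms are principal, so each argument costs at most `π`.
  refine ⟨fun z => zetaLogMain (1 - z) + E (1 - z) + k * log (W (1 - z)) + log (q (1 - z)) +
    log (1 - u (1 - z)) + k * (Real.pi * I), R, C + k * Real.pi + Real.pi + Real.pi + k * Real.pi,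
    ?_, ?_, ?_⟩
  · rintro z ⟨h1, h2, h3⟩
    obtain ⟨hs, hsM⟩ := hmem z h1 h2 h3
    have hnhds := (isOpen_lowerQuadrant R₀ (1 / 4)).mem_nhds hs
    have hsub1 : DifferentiableAt ℂ (fun z : ℂ => 1 - z) z := by fun_prop
    have dH : DifferentiableAt ℂ (fun s => zetaLogMain s + E s) (1 - z) :=
      (hHd _ (hsub' hs)).differentiableAt
    have dW : DifferentiableAt ℂ W (1 - z) := (hWd.mono hsub').differentiableAt hnhds
    have dq : DifferentiableAt ℂ q (1 - z) := hq.differentiableAt hnhds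
    have du : DifferentiableAt ℂ u (1 - z) :=
      (((dH.fun_neg.cexp).const_mul _).fun_mul ((dW.fun_inv
        (slitPlane_ne_zero (hWs _ hs))).fun_pow k)).fun_mul
        (dq.fun_inv (slitPlane_ne_zero (hqs _ hs hsM)))
    have e1 := dH.comp z hsub1
    have e2 := ((dW.clog (hWs _ hs)).const_mul (k : ℂ)).comp z hsub1
    have e3 := (dq.clog (hqs _ hs hsM)).comp z hsub1
    have e4 := ((du.const_sub 1).clog (hus _ hs hsM)).comp z hsub1
    exact (((((e1.add e2).add e3).add e4).add_const _)).differentiableWithinAt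
  · intro z h1 h2 h3
    obtain ⟨hs, hsM⟩ := hmem z h1 h2 h3
    have hW0 := slitPlane_ne_zero (hWs _ hs)
    have hq0 := slitPlane_ne_zero (hqs _ hs hsM)
    have hu0 := slitPlane_ne_zero (hus _ hs hsM)
    have h4 := hfq _ hs
    rw [iteratedDeriv_comp_const_sub k riemannZeta 1] at h4
    simp only [sub_sub_cancel, smul_eq_mul] at h4
    have hsq : ((-1 : ℂ) ^ k) * (-1) ^ k = 1 := by rw [← mul_pow]; norm_num
    have h5 : iteratedDeriv k riemannZeta z =
        (-1) ^ k * (exp (zetaLogMain (1 - z) + E (1 - z)) * W (1 - z) ^ k * q (1 - z)) := by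
      rw [← h4, ← mul_assoc, hsq, one_mul]
    rw [h5, exp_add _ ((k : ℂ) * (Real.pi * I)), exp_add _ (log (1 - u (1 - z))),
      exp_add _ (log (q (1 - z))), exp_add _ (k * log (W (1 - z))), exp_nat_mul, exp_nat_mul,
      exp_log hW0, exp_log hq0, exp_log hu0, exp_pi_mul_I]
    have key : ∀ e w q : ℂ, e ≠ 0 → w ≠ 0 → q ≠ 0 → (-1) ^ k * (e * w ^ k * q) - a =
        e * w ^ k * q * (1 - a * (-1) ^ k * e⁻¹ * w⁻¹ ^ k * q⁻¹) * (-1) ^ k := by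
      intro e w q he hw hq
      rw [inv_pow]
      field_simp
      linear_combination a * hsq
    simp only [hu, exp_neg]
    exact key _ _ _ (exp_ne_zero _) hW0 hq0
  · intro z h1 h2 h3
    obtain ⟨hs, hsM⟩ := hmem z h1 h2 h3
    have e1 := abs_le.1 ((abs_im_le_norm _).trans (hEQC (by norm_num) _ hs))
    have e2 := abs_le.1 (abs_arg_le_pi (W (1 - z)))
    have e3 := abs_le.1 (abs_arg_le_pi (q (1 - z)))
    have e4 := abs_le.1 (abs_arg_le_pi (1 - u (1 - z)))
    have hk0 : (0 : ℝ) ≤ k := Nat.cast_nonneg k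
    have e5 : ((k : ℂ) * log (W (1 - z))).im = k * arg (W (1 - z)) := by
      rw [← ofReal_natCast, im_ofReal_mul, log_im]
    have e6 : ((k : ℂ) * (Real.pi * I)).im = k * Real.pi := by
      rw [← ofReal_natCast, im_ofReal_mul, im_ofReal_mul]; simp
    have e7 := mul_le_mul_of_nonneg_left e2.1 hk0
    have e8 := mul_le_mul_of_nonneg_left e2.2 hk0
    have e9 : 0 ≤ k * Real.pi := by positivity
    simp only [add_im, log_im, e5, e6]
    rw [abs_le]
    constructor <;> linarith

/-! ### Growth of `ζ⁽ᵏ⁾` and its behaviour far to the right -/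

lemma analyticOnNhd_iteratedDeriv_riemannZeta (k : ℕ) :
    AnalyticOnNhd ℂ (iteratedDeriv k riemannZeta) {1}ᶜ := by
  have h : AnalyticOnNhd ℂ riemannZeta {1}ᶜ :=
    differentiableOn_riemannZeta.analyticOnNhd isOpen_compl_singleton
  rw [iteratedDeriv_eq_iterate]
  exact h.iterated_deriv k

lemma differentiableOn_iteratedDeriv_riemannZeta_sub (k : ℕ) (a : ℂ) :
    DifferentiableOn ℂ (fun z => iteratedDeriv k riemannZeta z - a) {z | 0 < z.im} := by
  refine ((analyticOnNhd_iteratedDeriv_riemannZeta k).differentiableOn.mono ?_).sub_const a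
  rintro z hz rfl
  simp at hz

/-- Polynomial growth of `ζ⁽ᵏ⁾` in half-planes, away from the real axis. -/
lemma exists_norm_iteratedDeriv_riemannZeta_le_pow (k : ℕ) (B : ℝ) :
    ∃ (C : ℝ) (A : ℕ), 0 ≤ C ∧ ∀ z : ℂ, -B ≤ z.re → 3 / 4 ≤ z.im →
      ‖iteratedDeriv k riemannZeta z‖ ≤ C * (5 + ‖z‖) ^ A := by
  obtain ⟨C, A, hC, h⟩ := exists_norm_riemannZeta_le_pow (B + 1)
  refine ⟨k.factorial * C / (1 / 4) ^ k, A, by positivity, fun z hz ht => ?_⟩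
  have key : ∀ w ∈ Metric.closedBall z (1 / 4), -(B + 1) ≤ w.re ∧ 1 / 2 ≤ w.im ∧
      ‖w‖ ≤ 1 + ‖z‖ := by
    intro w hw
    rw [mem_closedBall_iff_norm] at hw
    have e1 := abs_le.1 ((abs_re_le_norm (w - z)).trans hw)
    have e2 := abs_le.1 ((abs_im_le_norm (w - z)).trans hw)
    have e3 := norm_sub_norm_le w z
    simp only [sub_re, sub_im] at e1 e2
    exact ⟨by linarith, by linarith, by linarith⟩
  have hd : DiffContOnCl ℂ riemannZeta (Metric.ball z (1 / 4)) := by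
    refine (differentiableOn_riemannZeta.mono ?_).diffContOnCl
    rw [closure_ball z (by norm_num)]
    rintro w hw rfl
    have := (key 1 hw).2.1
    norm_num at this
  have h1 := norm_iteratedDeriv_le_of_forall_mem_sphere_norm_le (C := C * (5 + ‖z‖) ^ A) k
    (by norm_num) hd fun w hw => by
      obtain ⟨e1, e2, e3⟩ := key w (Metric.sphere_subset_closedBall hw)
      refine (h w e1 e2).trans ?_
      gcongr C * ?_ ^ A
      linarith
  refine h1.trans_eq ?_
  ring

/-- For `k ≥ 1` the derivatives of `ζ` and `ζ - 1` coincide, and `ζ - 1` decays exponentially in `re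
z`; Cauchy's estimate on unit discs transfers the decay. -/
lemma exists_norm_iteratedDeriv_riemannZeta_le {k : ℕ} (hk : 1 ≤ k) {ε : ℝ} (hε : 0 < ε) :
    ∃ c : ℝ, 3 ≤ c ∧ ∀ z : ℂ, c ≤ z.re → ‖iteratedDeriv k riemannZeta z‖ ≤ ε := by
  obtain ⟨n, hn⟩ := exists_pow_lt_of_lt_one
    (div_pos hε (by positivity : (0 : ℝ) < k.factorial)) (by norm_num : (1 / 2 : ℝ) < 1)
  refine ⟨3 + n, by linarith [Nat.cast_nonneg (α := ℝ) n], fun z hz => ?_⟩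
  have key : ∀ w ∈ Metric.closedBall z 1, 2 + n ≤ w.re := by
    intro w hw
    rw [mem_closedBall_iff_norm] at hw
    have e1 := abs_le.1 ((abs_re_le_norm (w - z)).trans hw)
    simp only [sub_re] at e1
    linarith
  have hn0 : (0 : ℝ) ≤ n := Nat.cast_nonneg n
  have hd : DiffContOnCl ℂ (fun w => riemannZeta w - 1) (Metric.ball z 1) := by
    refine ((differentiableOn_riemannZeta.mono ?_).sub_const 1).diffContOnCl
    rw [closure_ball z one_ne_zero]
    rintro w hw rfl
    have := key 1 hw
    norm_num at this
    linarith
  have hK : Real.pi ^ 2 / 6 - 1 ≤ 1 := by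
    have h1 := Real.pi_lt_d2
    have h2 := Real.pi_gt_three
    nlinarith
  have h1 := norm_iteratedDeriv_le_of_forall_mem_sphere_norm_le (C := (1 / 2 : ℝ) ^ n) k
    one_pos hd fun w hw => by
      have e1 := key w (Metric.sphere_subset_closedBall hw)
      refine (norm_riemannZeta_sub_one_le (by linarith)).trans ?_
      have e2 : (2 : ℝ) ^ (2 - w.re) ≤ 2 ^ (-(n : ℝ)) :=
        Real.rpow_le_rpow_of_exponent_le (by norm_num) (by linarith)
      rw [Real.rpow_neg (by norm_num), Real.rpow_natCast, ← inv_pow, ← one_div] at e2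
      exact (mul_le_of_le_one_right (by positivity) hK).trans e2
  have h2 : iteratedDeriv k (fun w => riemannZeta w - 1) z = iteratedDeriv k riemannZeta z := by
    obtain ⟨j, rfl⟩ := Nat.exists_eq_add_of_le' hk
    rw [iteratedDeriv_succ', iteratedDeriv_succ']
    congr 1
    funext w
    exact deriv_sub_const _
  rw [h2, one_pow, div_one] at h1
  refine h1.trans ?_
  rw [lt_div_iff₀ (by positivity)] at hn
  linarith

/-- Far to the right, `ζ⁽ᵏ⁾ - a` has a holomorphic logarithm with bounded imaginary part. -/
theorem exists_log_iteratedDeriv_riemannZeta_sub_right {k : ℕ} (hk : 1 ≤ k) {a : ℂ} (ha : a ≠ 0) :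
    ∃ (ℓ : ℂ → ℂ) (c : ℝ), 3 ≤ c ∧ DifferentiableOn ℂ ℓ {z | c < z.re} ∧
      (∀ z : ℂ, c < z.re → iteratedDeriv k riemannZeta z - a = exp (ℓ z)) ∧
      (∀ z : ℂ, c < z.re → |(ℓ z).im| ≤ 2 * Real.pi) ∧
      ∀ z : ℂ, c < z.re → ‖a‖ / 2 ≤ ‖iteratedDeriv k riemannZeta z - a‖ := by
  have ha0 : 0 < ‖a‖ := norm_pos_iff.2 ha
  obtain ⟨c, hc3, hc⟩ := exists_norm_iteratedDeriv_riemannZeta_le hk (half_pos ha0)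
  have hsl : ∀ z : ℂ, c < z.re → 1 - iteratedDeriv k riemannZeta z / a ∈ slitPlane := by
    intro z hz
    rw [sub_eq_add_neg]
    apply mem_slitPlane_of_norm_lt_one
    rw [norm_neg, norm_div, div_lt_one ha0]
    linarith [hc z hz.le]
  refine ⟨fun z => log (-a) + log (1 - iteratedDeriv k riemannZeta z / a), c, hc3,
    fun z hz => ?_, fun z hz => ?_, fun z hz => ?_, fun z hz => ?_⟩
  · have hz1 : z ∈ ({1}ᶜ : Set ℂ) := by
      rintro rfl
      have h1 : c < 1 := hz
      linarith
    have h1 : DifferentiableAt ℂ (iteratedDeriv k riemannZeta) z :=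
      (analyticOnNhd_iteratedDeriv_riemannZeta k z hz1).differentiableAt
    exact ((((h1.div_const a).const_sub 1).clog (hsl z hz)).const_add _).differentiableWithinAt
  · rw [exp_add, exp_log (neg_ne_zero.2 ha), exp_log (slitPlane_ne_zero (hsl z hz))]
    field_simp
    ring
  · have e1 := abs_le.1 (abs_arg_le_pi (-a))
    have e2 := abs_le.1 (abs_arg_le_pi (1 - iteratedDeriv k riemannZeta z / a))
    simp only [add_im, log_im]
    rw [abs_le]
    constructor <;> linarith
  · have h1 := norm_sub_norm_le a (iteratedDeriv k riemannZeta z)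
    rw [norm_sub_rev] at h1
    linarith [hc z hz.le]

/-! ### Argument variation along the edges and the main term -/

lemma hasDerivAt_logDeriv_of_eq_exp {F ℓ : ℂ → ℂ} {D : Set ℂ} (hD : IsOpen D)
    (hℓ : DifferentiableOn ℂ ℓ D) (h : ∀ z ∈ D, F z = exp (ℓ z)) {z : ℂ} (hz : z ∈ D) :
    HasDerivAt ℓ (logDeriv F z) z := by
  have h1 := (hℓ.differentiableAt (hD.mem_nhds hz)).hasDerivAt
  have h2 : F =ᶠ[𝓝 z] fun z => exp (ℓ z) := by
    filter_upwards [hD.mem_nhds hz] with w hw using h w hw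
  rw [logDeriv_apply, h2.deriv_eq, h1.cexp.deriv, h z hz, mul_div_cancel_left₀ _ (exp_ne_zero _)]
  exact h1

/-- The point is `1 - z` for `z = -2 + iT` on the left edge. Replacing `log ‖3 - iT‖` by `log T`
costs at most `9/(2T²)`, harmless after multiplication by `T`. -/
lemma abs_im_zetaLogMain_sub_le {T : ℝ} (hT : 1 ≤ T) :
    |(zetaLogMain (3 - T * I)).im - (T - T * Real.log (T / (2 * Real.pi)))| ≤
      4 * Real.pi + 9 / 2 := by
  have hT0 : 0 < T := by linarith
  have hre : (3 - T * I : ℂ).re = 3 := by simp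
  have him : (3 - T * I : ℂ).im = -T := by simp
  have hnsq : ‖(3 - T * I : ℂ)‖ ^ 2 = 9 + T ^ 2 := by
    rw [← normSq_eq_norm_sq, normSq_apply, hre, him]; ring
  set n := ‖(3 - T * I : ℂ)‖ with hn
  have hnT : T ≤ n := by
    have := abs_im_le_norm (3 - T * I : ℂ)
    rw [him, abs_neg, abs_of_pos hT0] at this
    exact this
  have hlog1 : 0 ≤ Real.log n - Real.log T := sub_nonneg.2 (Real.log_le_log hT0 hnT)
  have hlog2 : 2 * (Real.log n - Real.log T) ≤ 9 / T ^ 2 := by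
    have h1 : 2 * (Real.log n - Real.log T) = Real.log ((9 + T ^ 2) / T ^ 2) := by
      rw [Real.log_div (by positivity) (by positivity), ← hnsq, Real.log_pow, Real.log_pow]
      push_cast
      ring
    rw [h1]
    refine (Real.log_le_sub_one_of_pos (by positivity)).trans_eq ?_
    field_simp
    ring
  have hlog3 : T * (Real.log n - Real.log T) ≤ 9 / 2 := by
    have h1 : T * (2 * (Real.log n - Real.log T)) ≤ T * (9 / T ^ 2) :=
      mul_le_mul_of_nonneg_left hlog2 hT0.le
    have h2 : T * (9 / T ^ 2) ≤ 9 := by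
      rw [show T * (9 / T ^ 2) = 9 / T by field_simp]
      exact div_le_self (by norm_num) hT
    linarith
  have hlog4 : 0 ≤ T * (Real.log n - Real.log T) := by positivity
  have harg := abs_le.1 (abs_arg_le_pi (3 - T * I))
  rw [im_zetaLogMain, hre, him, ← hn, Real.log_div hT0.ne' (by positivity), abs_le]
  have hpi := Real.pi_pos
  constructor <;> nlinarith

/-- `Im ∫ F'/F` along a horizontal segment at height `T` is `O(log T)`, for `F = ζ⁽ᵏ⁾ - a`. -/
lemma exists_abs_im_integral_logDeriv_le (k : ℕ) {a : ℂ} (ha : a ≠ 0) {c : ℝ} (hc : 3 ≤ c)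
    (hca : ∀ z : ℂ, c ≤ z.re → ‖a‖ / 2 ≤ ‖iteratedDeriv k riemannZeta z - a‖) :
    ∃ K₁ K₂ T₁ : ℝ, 0 ≤ K₂ ∧ ∀ T : ℝ, T₁ ≤ T →
      (∀ x ∈ Icc (-2) c, iteratedDeriv k riemannZeta (x + T * I) - a ≠ 0) →
      |(∫ x : ℝ in (-2)..c, logDeriv (fun z => iteratedDeriv k riemannZeta z - a)
        (x + T * I)).im| ≤ K₁ + K₂ * Real.log T := by
  have ha0 : 0 < ‖a‖ := norm_pos_iff.2 ha
  -- With this radius the disc about `c + iT` contains the whole segment from `-2 + iT`.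
  set r := c + 2 with hr
  have hr0 : 0 < r := by linarith
  obtain ⟨C, A, hC, hgrow⟩ := exists_norm_iteratedDeriv_riemannZeta_le_pow k (6 * r)
  set D := 5 + c + 6 * r with hD
  refine ⟨20 * (Real.log ((C + ‖a‖) * 2 ^ A / (‖a‖ / 2)) + 1), 20 * A, D + 1, by positivity,
    fun T hT hne => ?_⟩
  have hT1 : 1 ≤ T := by linarith
  set s₀ : ℂ := c + T * I with hs₀
  have hs₀re : s₀.re = c := by simp [hs₀]
  have hs₀im : s₀.im = T := by simp [hs₀]
  have hs₀n : ‖s₀‖ ≤ c + T := by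
    refine (norm_add_le _ _).trans (le_of_eq ?_)
    rw [norm_mul, norm_I, mul_one, norm_real, norm_real, Real.norm_of_nonneg (by linarith),
      Real.norm_of_nonneg (by linarith)]
  have hball : ∀ z ∈ Metric.closedBall s₀ (6 * r), -(6 * r) ≤ z.re ∧ 1 ≤ z.im ∧
      5 + ‖z‖ ≤ 2 * T := by
    intro z hz
    rw [mem_closedBall_iff_norm] at hz
    have e1 := abs_le.1 ((abs_re_le_norm (z - s₀)).trans hz)
    have e2 := abs_le.1 ((abs_im_le_norm (z - s₀)).trans hz)
    have e3 := norm_sub_norm_le z s₀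
    simp only [sub_re, sub_im, hs₀re, hs₀im] at e1 e2
    exact ⟨by linarith, by linarith, by linarith⟩
  have hFs₀ := hca s₀ hs₀re.ge
  have hFs₀' : 0 < ‖iteratedDeriv k riemannZeta s₀ - a‖ := by linarith
  have hM : ∀ z ∈ Metric.closedBall s₀ (6 * r),
      ‖iteratedDeriv k riemannZeta z - a‖ ≤ (C + ‖a‖) * (2 * T) ^ A := by
    intro z hz
    obtain ⟨e1, e2, e3⟩ := hball z hz
    have e4 := hgrow z e1 (by linarith)
    have e5 : C * (5 + ‖z‖) ^ A ≤ C * (2 * T) ^ A := by gcongr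
    have e6 : 1 ≤ (2 * T) ^ A := one_le_pow₀ (by linarith)
    have e7 := norm_sub_le (iteratedDeriv k riemannZeta z) a
    nlinarith
  have hmain := abs_im_integral_logDeriv_le (F := fun z => iteratedDeriv k riemannZeta z - a)
    (s₀ := s₀) (r := r) (y := T) (x₀ := -2) (x₁ := c)
    (isOpen_lt continuous_const continuous_im) (convex_halfSpace_im_gt 0).isPreconnected
    (differentiableOn_iteratedDeriv_riemannZeta_sub k a) hr0
    (fun z hz => by show 0 < z.im; linarith [(hball z hz).2.1]) (norm_pos_iff.1 hFs₀') hM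
    (by linarith)
    (fun x hx => by
      rw [mem_closedBall_iff_norm, hs₀, add_sub_add_right_eq_sub, ← ofReal_sub, norm_real,
        Real.norm_eq_abs, abs_le]
      constructor <;> linarith [hx.1, hx.2])
    hne
  refine hmain.trans ?_
  have hlog : Real.log ((C + ‖a‖) * (2 * T) ^ A / ‖iteratedDeriv k riemannZeta s₀ - a‖) ≤
      Real.log ((C + ‖a‖) * 2 ^ A / (‖a‖ / 2)) + A * Real.log T := by
    rw [← Real.log_pow, ← Real.log_mul (by positivity) (by positivity)]
    refine Real.log_le_log (by positivity) ?_
    calc (C + ‖a‖) * (2 * T) ^ A / ‖iteratedDeriv k riemannZeta s₀ - a‖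
        ≤ (C + ‖a‖) * (2 * T) ^ A / (‖a‖ / 2) := by gcongr
      _ = (C + ‖a‖) * 2 ^ A / (‖a‖ / 2) * T ^ A := by rw [mul_pow]; ring
  linarith

/-- The main term of the counting function. -/
noncomputable def countMain (T : ℝ) : ℝ :=
  T / (2 * Real.pi) * Real.log (T / (2 * Real.pi)) - T / (2 * Real.pi)

lemma hasDerivAt_countMain {x : ℝ} (hx : 0 < x) :
    HasDerivAt countMain (Real.log (x / (2 * Real.pi)) / (2 * Real.pi)) x := by
  have h1 : HasDerivAt (fun x : ℝ => x / (2 * Real.pi)) (1 / (2 * Real.pi)) x :=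
    (hasDerivAt_id x).div_const _
  have h2 := h1.log (by positivity)
  convert! (h1.mul h2).sub h1 using 1
  field_simp
  ring

lemma abs_countMain_sub_le {T T' : ℝ} (hT : 2 * Real.pi + 1 ≤ T) (h1 : T - 1 ≤ T') (h2 : T' ≤ T) :
    |countMain T - countMain T'| ≤ Real.log T := by
  have hpi := Real.pi_gt_three
  have h0 : 0 ≤ Real.log T := Real.log_nonneg (by linarith)
  have h := norm_image_sub_le_of_norm_deriv_le_segment' (f := countMain)
    (f' := fun x => Real.log (x / (2 * Real.pi)) / (2 * Real.pi)) (C := Real.log T) (a := T')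
    (b := T) (fun x hx => (hasDerivAt_countMain (by linarith [hx.1])).hasDerivWithinAt)
    (fun x hx => by
      have e1 : 1 ≤ x / (2 * Real.pi) := by
        rw [le_div_iff₀ (by positivity)]; linarith [hx.1]
      have e2 : 0 ≤ Real.log (x / (2 * Real.pi)) := Real.log_nonneg e1
      rw [Real.norm_of_nonneg (by positivity)]
      refine (div_le_self e2 (by linarith)).trans (Real.log_le_log (by linarith) ?_)
      exact (div_le_self (by linarith [hx.1]) (by linarith)).trans hx.2.le) T ⟨h2, le_rfl⟩
  rw [Real.norm_eq_abs] at h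
  refine h.trans (mul_le_of_le_one_right h0 (by linarith))

/-! ### Counting the `a`-points -/

section

variable {k : ℕ} {a : ℂ}

lemma analyticOrderAt_iteratedDeriv_riemannZeta_sub_ne_top (hk : 1 ≤ k) (ha : a ≠ 0) {z : ℂ}
    (hz : 0 < z.im) : analyticOrderAt (fun z => iteratedDeriv k riemannZeta z - a) z ≠ ⊤ := by
  obtain ⟨-, c, -, -, -, -, hc⟩ := exists_log_iteratedDeriv_riemannZeta_sub_right hk ha
  have ha0 : 0 < ‖a‖ := norm_pos_iff.2 ha
  refine analyticOrderAt_ne_top_of_ne_zero (isOpen_lt continuous_const continuous_im)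
    (convex_halfSpace_im_gt 0).isPreconnected
    (differentiableOn_iteratedDeriv_riemannZeta_sub k a) (s₀ := (c + 1 : ℝ) + I) (by simp)
    (norm_pos_iff.1 (lt_of_lt_of_le (half_pos ha0) (hc _ (by simp)))) hz

/-- An exponential never vanishes, so the left and right logarithms confine the `a`-points to a
compact rectangle. -/
lemma zetaDerivAPoints_finite (hk : 1 ≤ k) (ha : a ≠ 0) (T : ℝ) :
    (zetaDerivAPoints k a 1 T).Finite := by
  obtain ⟨ℓ₁, R, -, -, h₁, -⟩ := exists_log_iteratedDeriv_riemannZeta_sub_left k a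
  obtain ⟨-, c, -, -, -, -, hc⟩ := exists_log_iteratedDeriv_riemannZeta_sub_right hk ha
  have ha0 : 0 < ‖a‖ := norm_pos_iff.2 ha
  have hfin := finite_zeros_of_isCompact (isOpen_lt continuous_const continuous_im)
    (convex_halfSpace_im_gt 0).isPreconnected
    (differentiableOn_iteratedDeriv_riemannZeta_sub k a) (s₀ := (c + 1 : ℝ) + I) (by simp)
    (norm_pos_iff.1 (lt_of_lt_of_le (half_pos ha0) (hc _ (by simp))))
    ((isCompact_Icc (a := -(max R 2)) (b := c)).reProdIm (isCompact_Icc (a := 1) (b := T)))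
    (fun z hz => by
      have := hz.2.1
      show 0 < z.im
      linarith)
  refine hfin.subset fun z hz => ?_
  obtain ⟨-, h0, h2, h3⟩ := hz
  have h0' : iteratedDeriv k riemannZeta z - a = 0 := sub_eq_zero.2 h0
  refine ⟨⟨⟨?_, ?_⟩, h2.le, h3.le⟩, h0'⟩
  · by_contra hlt
    have hlt : z.re < -(max R 2) := not_le.1 hlt
    have e1 := le_max_left R 2
    have e2 := le_max_right R 2
    have e3 := (abs_le.1 (abs_re_le_norm z)).1
    refine exp_ne_zero (ℓ₁ z) ?_
    rw [← h₁ z (by linarith) (by linarith) (by linarith), h0']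
  · by_contra hlt
    have := hc z (not_le.1 hlt)
    rw [h0', norm_zero] at this
    linarith

/-- `analyticOrderNatAt` takes the default value `0` at infinite order; positivity certifies that
every `a`-point is really counted. -/
lemma zetaDerivAPointMult_pos (hk : 1 ≤ k) (ha : a ≠ 0) {T : ℝ} {s : ℂ}
    (hs : s ∈ zetaDerivAPoints k a 1 T) : 0 < zetaDerivAPointMult k a s := by
  obtain ⟨-, h0, h2, -⟩ := hs
  have him : 0 < s.im := by linarith
  have htop := analyticOrderAt_iteratedDeriv_riemannZeta_sub_ne_top hk ha him
  have hA : AnalyticAt ℂ (fun z => iteratedDeriv k riemannZeta z - a) s :=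
    (differentiableOn_iteratedDeriv_riemannZeta_sub k a).analyticAt
      ((isOpen_lt continuous_const continuous_im).mem_nhds him)
  have hne := hA.analyticOrderAt_ne_zero.2 (sub_eq_zero.2 h0)
  rw [← Nat.cast_analyticOrderNatAt htop] at hne
  exact Nat.pos_of_ne_zero fun h => hne (by
    rw [show analyticOrderNatAt (fun z => iteratedDeriv k riemannZeta z - a) s = 0 from h]; rfl)

lemma zetaDerivAPointCount_eq_sum (hk : 1 ≤ k) (ha : a ≠ 0) (T : ℝ) :
    zetaDerivAPointCount k a 1 T =
      ∑ s ∈ (zetaDerivAPoints_finite hk ha T).toFinset, zetaDerivAPointMult k a s :=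
  finsum_mem_eq_finite_toFinset_sum _ _

/-- The counting formula at heights which are not attained by `a`-points. -/
lemma exists_abs_zetaDerivAPointCount_sub_le (hk : 1 ≤ k) (ha : a ≠ 0) :
    ∃ K₁ K₂ T₁ : ℝ, 0 ≤ K₁ ∧ 0 ≤ K₂ ∧ ∀ T : ℝ, T₁ ≤ T →
      (∀ z : ℂ, z.im = T → iteratedDeriv k riemannZeta z ≠ a) →
      |(zetaDerivAPointCount k a 1 T : ℝ) - countMain T| ≤ K₁ + K₂ * Real.log T := by
  obtain ⟨ℓ₁, R, C, hd₁, he₁, hi₁⟩ := exists_log_iteratedDeriv_riemannZeta_sub_left k a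
  obtain ⟨ℓ₂, c₀, hc₀, hd₂, he₂, hi₂, hc⟩ := exists_log_iteratedDeriv_riemannZeta_sub_right hk ha
  set c := c₀ + 1 with hcdef
  set F : ℂ → ℂ := fun z => iteratedDeriv k riemannZeta z - a with hF
  obtain ⟨B₁, B₂, T₁, hB₂, htop⟩ := exists_abs_im_integral_logDeriv_le k ha (c := c) (by linarith)
    fun z hz => hc z (by linarith)
  have hUo : IsOpen {z : ℂ | 0 < z.im} := isOpen_lt continuous_const continuous_im
  have hFd : DifferentiableOn ℂ F {z | 0 < z.im} :=
    differentiableOn_iteratedDeriv_riemannZeta_sub k a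
  have hD₁ : IsOpen {z : ℂ | z.re < -(3 / 2) ∧ 3 / 4 < z.im ∧ R < ‖z‖} :=
    (isOpen_lt continuous_re continuous_const).inter
      ((isOpen_lt continuous_const continuous_im).inter (isOpen_lt continuous_const continuous_norm))
  have hD₂ : IsOpen {z : ℂ | c₀ < z.re} := isOpen_lt continuous_const continuous_re
  -- a height below which the `a`-points are ignored
  obtain ⟨T₀, ⟨hT₀, hT₀X⟩, hT₀ne⟩ : ∃ T₀ ∈ Ioo (max R 2) (max R 2 + 1),
      T₀ ∉ im '' zetaDerivAPoints k a 1 (max R 2 + 1) := by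
    have h1 := (Ioo_infinite (show max R 2 < max R 2 + 1 by linarith)).sdiff
      ((zetaDerivAPoints_finite hk ha (max R 2 + 1)).image im)
    obtain ⟨x, hx, hx'⟩ := h1.nonempty
    exact ⟨x, hx, hx'⟩
  -- Since `T₀ > R`, the condition `R < ‖z‖` is automatic for `im z ≥ T₀`, so the left logarithm is
  -- available on the whole left edge and beyond.
  have hR := le_max_left R 2
  have h2 := le_max_right R 2
  have hz₀ : ∀ z : ℂ, z.im = T₀ → F z ≠ 0 := fun z hz h0 =>
    hT₀ne ⟨z, ⟨by rintro rfl; rw [one_im] at hz; linarith, sub_eq_zero.1 h0, by linarith,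
      by linarith⟩, hz⟩
  have hloc : ∀ z : ℂ, T₀ ≤ z.im → F z = 0 → -(3 / 2) ≤ z.re ∧ z.re ≤ c₀ := by
    intro z hz h0
    constructor
    · by_contra hlt
      have e1 := (abs_le.1 (abs_im_le_norm z)).2
      refine exp_ne_zero (ℓ₁ z) ?_
      rw [← he₁ z (not_le.1 hlt) (by linarith) (by linarith)]
      exact h0
    · by_contra hlt
      refine exp_ne_zero (ℓ₂ z) ?_
      rw [← he₂ z (not_le.1 hlt)]
      exact h0
  set b₀ := (∫ x : ℝ in (-2)..c, logDeriv F (x + T₀ * I)).im with hb₀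
  set l₀ := (ℓ₁ ((-2 : ℝ) + T₀ * I)).im with hl₀
  set K := |b₀| + |B₁| + 4 * Real.pi + |l₀| + |C| + (4 * Real.pi + 9 / 2) with hK
  have hK0 : 0 ≤ K := by positivity
  -- The `a`-points below `T₀` are absorbed into the constant.
  refine ⟨K + zetaDerivAPointCount k a 1 T₀, B₂, max T₁ (T₀ + 1), by positivity, hB₂,
    fun T hT hTne => ?_⟩
  have hTT₁ : T₁ ≤ T := (le_max_left _ _).trans hT
  have hTT₀ : T₀ + 1 ≤ T := (le_max_right _ _).trans hT
  have hzT : ∀ z : ℂ, z.im = T → F z ≠ 0 := fun z hz h0 => hTne z hz (sub_eq_zero.1 h0)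
  set Z := (zetaDerivAPoints_finite hk ha T).toFinset with hZ
  have hZmem : ∀ z, z ∈ Z ↔ F z = 0 ∧ 1 < z.im ∧ z.im < T := fun z => by
    rw [hZ, Set.Finite.mem_toFinset]
    exact ⟨fun h => ⟨sub_eq_zero.2 h.2.1, h.2.2⟩, fun h =>
      ⟨by rintro rfl; have := h.2.1; rw [one_im] at this; linarith, sub_eq_zero.1 h.1, h.2⟩⟩
  set S := Z.filter (fun z => T₀ < z.im) with hS
  have hsplit : zetaDerivAPointCount k a 1 T =
      ∑ z ∈ S, analyticOrderNatAt F z + zetaDerivAPointCount k a 1 T₀ := by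
    rw [zetaDerivAPointCount_eq_sum hk ha T, zetaDerivAPointCount_eq_sum hk ha T₀,
      ← Finset.sum_filter_add_sum_filter_not Z (fun z => T₀ < z.im)]
    congr 1
    refine Finset.sum_congr ?_ fun _ _ => rfl
    ext z
    rw [Finset.mem_filter, hZmem, Set.Finite.mem_toFinset, not_lt]
    constructor
    · rintro ⟨⟨e1, e2, e3⟩, e4⟩
      exact ⟨by rintro rfl; rw [one_im] at e2; linarith, sub_eq_zero.1 e1, e2,
        lt_of_le_of_ne e4 fun h => hz₀ z h e1⟩
    · rintro ⟨-, e1, e2, e3⟩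
      exact ⟨⟨sub_eq_zero.2 e1, e2, by linarith⟩, e3.le⟩
  have hSmem : ∀ z, z ∈ S ↔ F z = 0 ∧ T₀ < z.im ∧ z.im < T := fun z => by
    rw [hS, Finset.mem_filter, hZmem]
    constructor
    · rintro ⟨⟨e1, -, e3⟩, e4⟩
      exact ⟨e1, e4, e3⟩
    · rintro ⟨e1, e2, e3⟩
      exact ⟨⟨e1, by linarith, e3⟩, e2⟩
  have hrect := rectIntegral_logDeriv hUo hFd (x₀ := -2) (x₁ := c) (y₀ := T₀) (y₁ := T)
    (by linarith) (by linarith) (fun z hz => by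
      show 0 < z.im
      linarith [hz.2.1]) S
    (fun z hz hz' => by
      rw [hSmem]
      exact ⟨fun h0 => ⟨h0, lt_of_le_of_ne hz'.1 fun h => hz₀ z h.symm h0,
        lt_of_le_of_ne hz'.2 fun h => hzT z h h0⟩, fun h => h.1⟩)
    (fun z hz => by
      obtain ⟨e1, e2, e3⟩ := (hSmem z).1 hz
      have e4 := hloc z e2.le e1
      exact ⟨⟨by linarith, by linarith⟩, e2, e3⟩)
    (fun z hz => analyticOrderAt_iteratedDeriv_riemannZeta_sub_ne_top hk ha
      (by linarith [((hSmem z).1 hz).2.1]))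
  have hright : I * ∫ y : ℝ in T₀..T, logDeriv F (c + y * I) =
      ℓ₂ (c + T * I) - ℓ₂ (c + T₀ * I) := by
    have hmem : ∀ y ∈ uIcc T₀ T, (c + y * I : ℂ) ∈ {z : ℂ | c₀ < z.re ∧ 0 < z.im} := by
      intro y hy
      rw [uIcc_of_le (by linarith)] at hy
      exact ⟨by simp [hcdef], by simp; linarith [hy.1]⟩
    refine integral_vertical_of_hasDerivAt
      (fun y hy => hasDerivAt_logDeriv_of_eq_exp hD₂ hd₂ he₂ (hmem y hy).1) ?_
    exact (continuousOn_logDeriv hUo hFd (fun z (hz : z ∈ {z : ℂ | c₀ < z.re ∧ 0 < z.im}) => hz.2)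
      fun z hz => by
        show iteratedDeriv k riemannZeta z - a ≠ 0
        rw [he₂ z hz.1]; exact exp_ne_zero _).comp (f := fun y : ℝ => (c + y * I : ℂ))
        (by fun_prop) hmem
  have hleft : I * ∫ y : ℝ in T₀..T, logDeriv F (((-2 : ℝ) : ℂ) + y * I) =
      ℓ₁ (((-2 : ℝ) : ℂ) + T * I) - ℓ₁ (((-2 : ℝ) : ℂ) + T₀ * I) := by
    have hmem : ∀ y ∈ uIcc T₀ T, (((-2 : ℝ) : ℂ) + y * I : ℂ) ∈
        {z : ℂ | z.re < -(3 / 2) ∧ 3 / 4 < z.im ∧ R < ‖z‖} := by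
      intro y hy
      rw [uIcc_of_le (by linarith)] at hy
      have e1 := (abs_le.1 (abs_im_le_norm (((-2 : ℝ) : ℂ) + y * I))).2
      have e2 : (((-2 : ℝ) : ℂ) + y * I).im = y := by simp
      rw [e2] at e1
      refine ⟨by simp; norm_num, by rw [e2]; linarith [hy.1], by linarith [hy.1]⟩
    refine integral_vertical_of_hasDerivAt
      (fun y hy => hasDerivAt_logDeriv_of_eq_exp hD₁ hd₁
        (fun z hz => he₁ z hz.1 hz.2.1 hz.2.2) (hmem y hy)) ?_
    refine (continuousOn_logDeriv hUo hFd (fun z hz => ?_)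
      fun z hz => ?_).comp (f := fun y : ℝ => (((-2 : ℝ) : ℂ) + y * I : ℂ)) (by fun_prop) hmem
    · show 0 < z.im
      linarith [hz.2.1]
    · show iteratedDeriv k riemannZeta z - a ≠ 0
      rw [he₁ z hz.1 hz.2.1 hz.2.2]; exact exp_ne_zero _
  have htopT := htop T hTT₁ fun x _ => hzT _ (by simp)
  unfold rectIntegral at hrect
  rw [hright, hleft] at hrect
  have him := congrArg im hrect
  set n : ℕ := ∑ z ∈ S, analyticOrderNatAt F z with hn
  have hnim : (2 * Real.pi * I * (n : ℂ)).im = 2 * Real.pi * n := by simp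
  rw [hnim] at him
  simp only [sub_im, add_im] at him
  rw [← hl₀, ← hb₀] at him
  have hpi := Real.pi_gt_three
  have hmemT : R < ‖(((-2 : ℝ) : ℂ) + T * I)‖ := by
    have e1 := (abs_le.1 (abs_im_le_norm (((-2 : ℝ) : ℂ) + T * I))).2
    have e2 : (((-2 : ℝ) : ℂ) + T * I).im = T := by simp
    linarith
  have hl := abs_le.1 (hi₁ (((-2 : ℝ) : ℂ) + T * I) (by simp; norm_num) (by simp; linarith) hmemT)
  rw [show 1 - (((-2 : ℝ) : ℂ) + T * I) = 3 - T * I by push_cast; ring] at hl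
  have hm := abs_le.1 (abs_im_zetaLogMain_sub_le (T := T) (by linarith))
  have hr1 := abs_le.1 (hi₂ (c + T * I) (by simp [hcdef]))
  have hr2 := abs_le.1 (hi₂ (c + T₀ * I) (by simp [hcdef]))
  have ht := abs_le.1 htopT
  have hbabs := abs_le.1 (le_refl |b₀|)
  have hlabs := abs_le.1 (le_refl |l₀|)
  have hBabs := le_abs_self B₁
  have hCabs := le_abs_self C
  have hcm : 2 * Real.pi * countMain T = T * Real.log (T / (2 * Real.pi)) - T := by
    unfold countMain
    field_simp
  have hfin : |2 * Real.pi * (n - countMain T)| ≤ K + B₂ * Real.log T := by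
    rw [mul_sub, hcm, abs_le]
    constructor <;> linarith
  -- As `2π ≥ 1`, the division by `2π` only improves the bound.
  have hfin2 : |(n : ℝ) - countMain T| ≤ K + B₂ * Real.log T := by
    rw [abs_mul, abs_of_pos (by positivity : 0 < 2 * Real.pi)] at hfin
    nlinarith [abs_nonneg ((n : ℝ) - countMain T)]
  rw [hsplit]
  push_cast
  have hN : (0 : ℝ) ≤ zetaDerivAPointCount k a 1 T₀ := Nat.cast_nonneg _
  rw [abs_le] at hfin2 ⊢
  constructor <;> linarith [hfin2.1, hfin2.2]

end

theorem theorem1 (k : ℕ) (hk : 1 ≤ k) (a : ℂ) (ha : a ≠ 0) :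
    (∀ T : ℝ, (zetaDerivAPoints k a 1 T).Finite) ∧
    (∀ T : ℝ, ∀ s ∈ zetaDerivAPoints k a 1 T, 0 < zetaDerivAPointMult k a s) ∧
    Asymptotics.IsBigO Filter.atTop
      (fun T : ℝ => (zetaDerivAPointCount k a 1 T : ℝ) -
        (T / (2 * Real.pi) * Real.log (T / (2 * Real.pi)) - T / (2 * Real.pi)))
      (fun T : ℝ => Real.log T) := by
  refine ⟨zetaDerivAPoints_finite hk ha, fun T s hs => zetaDerivAPointMult_pos hk ha hs, ?_⟩
  obtain ⟨K₁, K₂, T₁, hK₁, hK₂, hmain⟩ := exists_abs_zetaDerivAPointCount_sub_le hk ha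
  refine Asymptotics.IsBigO.of_bound (K₁ + K₂ + 1) ?_
  filter_upwards [eventually_ge_atTop (T₁ + 1), eventually_ge_atTop (2 * Real.pi + 1)] with T h1 h2
  have hpi := Real.pi_gt_three
  have hlog : 1 ≤ Real.log T := by
    rw [Real.le_log_iff_exp_le (by linarith)]
    linarith [Real.exp_one_lt_d9]
  have hfin := zetaDerivAPoints_finite hk ha T
  -- Finitely many `a`-points lie strictly below `T`, so some `T' < T` exceeds all their heights.
  -- Then no `a`-point has height `T'`, and the count is the same as at `T`.
  have hev : ∀ᶠ T' in 𝓝[<] T, (∀ z ∈ zetaDerivAPoints k a 1 T, z.im < T') ∧ T - 1 < T' ∧ T' < T := by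
    refine ((Filter.eventually_all_finite hfin).2 fun z hz => ?_).and
      (((eventually_gt_nhds (by linarith : T - 1 < T)).filter_mono nhdsWithin_le_nhds).and
        self_mem_nhdsWithin)
    exact (eventually_gt_nhds hz.2.2.2).filter_mono nhdsWithin_le_nhds
  obtain ⟨T', hT'1, hT'2, hT'3⟩ := hev.exists
  have hsets : zetaDerivAPoints k a 1 T' = zetaDerivAPoints k a 1 T := by
    ext z
    exact ⟨fun h => ⟨h.1, h.2.1, h.2.2.1, h.2.2.2.trans hT'3⟩,
      fun h => ⟨h.1, h.2.1, h.2.2.1, hT'1 z h⟩⟩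
  have hcount : zetaDerivAPointCount k a 1 T' = zetaDerivAPointCount k a 1 T := by
    rw [zetaDerivAPointCount, hsets, zetaDerivAPointCount]
  have hne : ∀ z : ℂ, z.im = T' → iteratedDeriv k riemannZeta z ≠ a := fun z hz h0 => by
    have := hT'1 z ⟨by rintro rfl; rw [one_im] at hz; linarith, h0, by linarith, by linarith⟩
    linarith
  have e1 := hmain T' (by linarith) hne
  have e2 := abs_countMain_sub_le h2 hT'2.le hT'3.le
  have e3 : Real.log T' ≤ Real.log T := Real.log_le_log (by linarith) hT'3.le
  rw [hcount] at e1
  have e4 : K₂ * Real.log T' ≤ K₂ * Real.log T := mul_le_mul_of_nonneg_left e3 hK₂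
  have e5 : K₁ ≤ K₁ * Real.log T := le_mul_of_one_le_right hK₁ hlog
  rw [Real.norm_eq_abs, Real.norm_of_nonneg (by linarith)]
  change |(zetaDerivAPointCount k a 1 T : ℝ) - countMain T| ≤ _
  rw [abs_le] at e1 e2 ⊢
  constructor <;> linarith [e1.1, e1.2, e2.1, e2.2]
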